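/- Let $M_r(\mathbb C)$ carry the real inner product $\langle A,B\rangle=\operatorname{Re}\operatorname{tr}(B^*A)$, and let $D=\operatorname{diag}(d_1,\dots,d_r)\in M_r(\mathbb C)$ be diagonal and invertible. Let $\mathcal S(D)=\{SDS^{-1}: S \text{ invertible}\}$ and $\mathcal U(D)=\{UDU^*: U\text{ unitary}\}$ be its similarity and unitary orbits. For $\lambda\in(0,1)$ let $\Delta_\lambda(T)=|T|^{\lambda}U|T|^{1-\lambda}$ be the $\lambda$-Aluthge transform, where $T=U|T|$ is the polar decomposition. For every $\lambda\in(0,1)$ and $N\in\mathcal U(D)$ the map $\Delta_\lambda$ is differentiable at $N$, and there is exactly one real subspace $E^s_{N,\lambda}$ of $T_N\mathcal S(D)$ such that $T_N\mathcal S(D)=E^s_{N,\lambda}\oplus T_N\mathcal U(D)$, both summands are invariant under the derivative $T_N\Delta_\lambda$, and the restriction of $T_N\Delta_\lambda$ to $E^s_{N,\lambda}$ has operator norm less than $1$. With these subspaces, the following conditions are equivalent: 1. for every $N\in\mathcal U(D)$ the map $(0,1)\ni\lambda\mapsto E^s_{N,\lambda}$ is constant; 2. $|d_i|=|d_j|$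 for all $1\le i,j\le r$. Moreover, in this case, for every $N\in\mathcal U(D)$ and every $\lambda\in(0,1)$, $E^s_{N,\lambda}$ is the orthogonal complement of $T_N\mathcal U(D)$ in $T_N\mathcal S(D)$. -/

import Mathlib

open scoped Matrix ContDiff

attribute [local instance] Matrix.frobeniusNormedAddCommGroup Matrix.frobeniusNormedSpace

noncomputable section

namespace AluthgeStable

/-- The similarity orbit `{S D S⁻¹ : S invertible}`. -/
def similarityOrbit {r : ℕ} (D : Matrix (Fin r) (Fin r) ℂ) : Set (Matrix (Fin r) (Fin r) ℂ) :=
  {T | ∃ S : (Matrix (Fin r) (Fin r) ℂ)ˣ, T = (S : Matrix (Fin r) (Fin r) ℂ) * D * (S⁻¹).val}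

/-- The unitary orbit `{U D U* : U unitary}`. -/
def unitaryOrbit {r : ℕ} (D : Matrix (Fin r) (Fin r) ℂ) : Set (Matrix (Fin r) (Fin r) ℂ) :=
  {T | ∃ U ∈ Matrix.unitaryGroup (Fin r) ℂ, T = U * D * Uᴴ}

/-- The power `|T|^s = (T* T)^(s/2)` of the modulus of `T`, by the functional calculus of the
positive semidefinite matrix `T* T`. Since `0 ^ x = 0` for `x ≠ 0`, a negative power is the
corresponding power of the Moore-Penrose inverse of `|T|`. -/
def absPow {r : ℕ} (T : Matrix (Fin r) (Fin r) ℂ) (s : ℝ) : Matrix (Fin r) (Fin r) ℂ :=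
  cfc (fun x : ℝ => x ^ (s / 2)) (Tᴴ * T)

/-- The partial isometry `U` of the polar decomposition `T = U |T|` with `ker U = ker T`,
written as `T |T|^{-1}` with the Moore-Penrose inverse of `|T|`
(which is the unitary `T |T|⁻¹` when `T` is invertible). -/
def polarFactor {r : ℕ} (T : Matrix (Fin r) (Fin r) ℂ) : Matrix (Fin r) (Fin r) ℂ :=
  T * absPow T (-1)

/-- The `l`-Aluthge transform `|T|^l U |T|^(1-l)`, where `T = U |T|` is the polar
decomposition. -/
def aluthge {r : ℕ} (l : ℝ) (T : Matrix (Fin r) (Fin r) ℂ) : Matrix (Fin r) (Fin r) ℂ :=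
  absPow T l * polarFactor T * absPow T (1 - l)

/-- The tangent space at `x` of a smooth submanifold `S` of the matrix space, as the real span of
the velocities at `x` of the smooth curves in `S` through `x`. (For a submanifold the velocities
already form a linear subspace.) -/
def tangentSpaceAt {r : ℕ} (S : Set (Matrix (Fin r) (Fin r) ℂ)) (x : Matrix (Fin r) (Fin r) ℂ) :
    Submodule ℝ (Matrix (Fin r) (Fin r) ℂ) :=
  Submodule.span ℝ {v | ∃ γ : ℝ → Matrix (Fin r) (Fin r) ℂ,
    ContDiff ℝ ∞ γ ∧ (∀ t, γ t ∈ S) ∧ γ 0 = x ∧ deriv γ 0 = v}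

/-- The orthogonal complement of a subspace `F` inside a subspace `V`, for the real inner
product `⟨A, B⟩ = Re tr (B* A)`. -/
def orthIn {r : ℕ} (V F : Submodule ℝ (Matrix (Fin r) (Fin r) ℂ)) :
    Submodule ℝ (Matrix (Fin r) (Fin r) ℂ) where
  carrier := {X | X ∈ V ∧ ∀ Y ∈ F, ((Yᴴ * X).trace).re = 0}
  zero_mem' := ⟨V.zero_mem, fun Y _ => by simp⟩
  add_mem' := fun {a b} ha hb => ⟨V.add_mem ha.1 hb.1, fun Y hY => by
    simp [Matrix.mul_add, ha.2 Y hY, hb.2 Y hY]⟩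
  smul_mem' := fun c a ha => ⟨V.smul_mem c ha.1, fun Y hY => by
    simp [Matrix.trace_smul, ha.2 Y hY]⟩

/-- `E` is a stable subspace at the point `N` of the unitary orbit of `D` for the `l`-Aluthge
transform: it is a complement of the tangent space of the unitary orbit in the tangent space of
the similarity orbit, both summands are invariant under the derivative at `N`, and the
derivative restricted to `E` has norm less than `1` (for the Frobenius norm). -/
structure IsStableSubspace {r : ℕ} (D : Matrix (Fin r) (Fin r) ℂ) (l : ℝ)
    (N : Matrix (Fin r) (Fin r) ℂ) (E : Submodule ℝ (Matrix (Fin r) (Fin r) ℂ)) : Prop where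
  inf_eq : E ⊓ tangentSpaceAt (unitaryOrbit D) N = ⊥
  sup_eq : E ⊔ tangentSpaceAt (unitaryOrbit D) N = tangentSpaceAt (similarityOrbit D) N
  invariant : ∀ X ∈ E, fderiv ℝ (aluthge l) N X ∈ E
  invariant_tangent : ∀ X ∈ tangentSpaceAt (unitaryOrbit D) N,
    fderiv ℝ (aluthge l) N X ∈ tangentSpaceAt (unitaryOrbit D) N
  contracting : ∃ k : ℝ, k < 1 ∧ ∀ X ∈ E, ‖fderiv ℝ (aluthge l) N X‖ ≤ k * ‖X‖

end AluthgeStable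

end

/-! Conjugation by a unitary commutes with the Aluthge transform, preserves both orbits and is a
real isometry, so it is enough to work at N = D.

At D the tangent space of the similarity orbit consists of the commutators X = [Y, D], and that of
the unitary orbit of those with Y skew-Hermitian. The Daletskii–Krein formula gives the derivative
of |T|^s at D, hence L = T_D Δ_l. In terms of Y, L sends Y i j to Y i j - a_ij (Y i j + conj (Y j
i)), where a_ij is `stableCoeff` (`sub_fderiv_aluthge_diagonal`). Hence L is the identity on the
unitary tangent space, and the range of 1 - L is {[a ∘ Z, D] : Z Hermitian}, with a ∘ Z the
entrywise product. On this range L multiplies the entry (i, j) by 1 - (a_ij + conj a_ji), which has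
modulus less than 1 whenever d i ≠ d j (`norm_one_sub_stableCoeff_lt_one`). So the range of 1 - L is
a stable subspace. It is the only one: on a stable F the contraction L makes 1 - L bijective, while
1 - L kills the unitary tangent space, so F = (1 - L)(T_D S(D))
(`IsStableSubspace.eq_stableSubspace`).

The parameter enters the subspace through the ratios a_ij / conj a_ji, which equal (|d i| / |d j|)^l
times a factor free of l. If two moduli differ, the subspace moves with l. If all moduli agree, a_ij
= conj a_ji, so the subspace consists of commutators [H, D] with H Hermitian, and these are
orthogonal to the commutators [K, D] with K skew-Hermitian. -/

noncomputable section

namespace AluthgeStable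

open Filter Topology

set_option linter.unusedSectionVars false

/-! ### Derivative of the Hermitian functional calculus at a real diagonal matrix -/

section FunctionalCalculus

variable {n : Type*} [Fintype n] [DecidableEq n]

/-- An entry of a matrix is bounded by its Frobenius norm. -/
lemma norm_entry_le_frobenius (A : Matrix n n ℂ) (i j : n) : ‖A i j‖ ≤ ‖A‖ := by
  rw [Matrix.frobenius_norm_def, ← Real.sqrt_eq_rpow]
  apply Real.le_sqrt_of_sq_le
  have h1 : ‖A i j‖ ^ (2 : ℝ) ≤ ∑ j, ‖A i j‖ ^ (2 : ℝ) :=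
    Finset.single_le_sum (f := fun j => ‖A i j‖ ^ (2 : ℝ)) (fun _ _ => by positivity)
      (Finset.mem_univ j)
  have h2 : ∑ j, ‖A i j‖ ^ (2 : ℝ) ≤ ∑ i, ∑ j, ‖A i j‖ ^ (2 : ℝ) :=
    Finset.single_le_sum (f := fun i => ∑ j, ‖A i j‖ ^ (2 : ℝ)) (fun _ _ => by positivity)
      (Finset.mem_univ i)
  rw [Real.rpow_two] at h1
  exact h1.trans h2

/-- The Frobenius norm is bounded by a multiple of the largest entry. -/
lemma exists_frobenius_le :
    ∃ C : ℝ, 0 < C ∧ ∀ (A : Matrix n n ℂ) (c : ℝ), 0 ≤ c → (∀ i j, ‖A i j‖ ≤ c) → ‖A‖ ≤ C * c := by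
  refine ⟨∑ i : n, ∑ j : n, ‖Matrix.single i j (1 : ℂ)‖ + 1, by positivity, fun A c hc h => ?_⟩
  have h1 : ‖A‖ ≤ ∑ i : n, ∑ j : n, ‖Matrix.single i j (1 : ℂ)‖ * c := by
    conv_lhs => rw [Matrix.matrix_eq_sum_single A]
    refine (norm_sum_le _ _).trans (Finset.sum_le_sum fun i _ => ?_)
    refine (norm_sum_le _ _).trans (Finset.sum_le_sum fun j _ => ?_)
    have : Matrix.single i j (A i j) = A i j • Matrix.single i j (1 : ℂ) := by
      simp [Matrix.smul_single]
    rw [this, norm_smul, mul_comm]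
    gcongr
    exact h i j
  simp_rw [← Finset.sum_mul] at h1
  linarith

/-- The spectral theorem in intertwining form: one V serves all f, and the identities can be read
entry by entry without inverting V. -/
lemma isHermitian_exists_diagonalization {B : Matrix n n ℂ} (hB : B.IsHermitian) :
    ∃ V ∈ Matrix.unitaryGroup n ℂ, ∃ b : n → ℝ,
      B * V = V * Matrix.diagonal (fun j => (b j : ℂ)) ∧
      ∀ f : ℝ → ℝ, cfc f B * V = V * Matrix.diagonal (fun j => (f (b j) : ℂ)) := by
  refine ⟨hB.eigenvectorUnitary, hB.eigenvectorUnitary.2, hB.eigenvalues, ?_, fun f => ?_⟩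
  · have h := congrArg (· * (hB.eigenvectorUnitary : Matrix n n ℂ)) hB.spectral_theorem
    simpa [Unitary.conjStarAlgAut_apply, Matrix.mul_assoc, Function.comp_def] using h
  · rw [hB.cfc_eq, Matrix.IsHermitian.cfc]
    simp [Unitary.conjStarAlgAut_apply, Matrix.mul_assoc, Function.comp_def]

lemma isHermitian_diagonal_ofReal (a : n → ℝ) :
    (Matrix.diagonal (fun i => (a i : ℂ))).IsHermitian := by
  rw [Matrix.IsHermitian, Matrix.diagonal_conjTranspose]
  congr 1
  ext i
  simp

lemma eq_of_mul_unitary {V X Y : Matrix n n ℂ} (hV : V ∈ Matrix.unitaryGroup n ℂ)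
    (h : X * V = Y * V) : X = Y := by
  have := congrArg (· * star V) h
  simpa [Matrix.mul_assoc, Matrix.mem_unitaryGroup_iff.1 hV] using this

/-- If V diagonalizes the matrix with eigenvalues b, then a i * V i j = V i j * b j, so a i = b j
wherever V i j ≠ 0, and f may be applied to both sides. -/
lemma cfc_diagonal_ofReal (f : ℝ → ℝ) (a : n → ℝ) :
    cfc f (Matrix.diagonal (fun i => (a i : ℂ))) = Matrix.diagonal (fun i => (f (a i) : ℂ)) := by
  obtain ⟨V, hV, b, hb, hf⟩ := isHermitian_exists_diagonalization (isHermitian_diagonal_ofReal a)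
  apply eq_of_mul_unitary hV
  rw [hf f]
  ext i j
  have := congrFun (congrFun hb i) j
  rw [Matrix.diagonal_mul, Matrix.mul_diagonal] at *
  by_cases h : V i j = 0
  · simp [h]
  · have : a i = b j := by
      rw [mul_comm] at this
      exact_mod_cast mul_left_cancel₀ h this
    rw [this, mul_comm]

lemma unitary_col_norm_sq_sum {V : Matrix n n ℂ} (hV : V ∈ Matrix.unitaryGroup n ℂ) (j : n) :
    ∑ m, ‖V m j‖ ^ 2 = 1 := by
  have := congrFun (congrFun (Matrix.mem_unitaryGroup_iff'.1 hV) j) j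
  rw [Matrix.mul_apply, Matrix.one_apply_eq] at this
  have h2 : ∀ m, star V j m * V m j = ((‖V m j‖ ^ 2 : ℝ) : ℂ) := fun m => by
    rw [Matrix.star_apply, RCLike.star_def, mul_comm, RCLike.mul_conj]
    simp
  simp_rw [h2] at this
  exact_mod_cast this

lemma unitary_entry_norm_le {V : Matrix n n ℂ} (hV : V ∈ Matrix.unitaryGroup n ℂ) (i j : n) :
    ‖V i j‖ ≤ 1 := entry_norm_bound_of_unitary hV i j

/-- The eigenvectors of a Hermitian perturbation of a diagonal matrix: the divided differences of
`f` at its eigenvalues are close to those at the diagonal entries, except where the eigenvector has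
a small coordinate. -/
lemma exists_dslope_sub_mul_le (f : ℝ → ℝ) (a : n → ℝ) (hf : ∀ i, DifferentiableAt ℝ f (a i))
    {ε : ℝ} (hε : 0 < ε) :
    ∃ δ > 0, ∀ B V : Matrix n n ℂ, ∀ b : n → ℝ, V ∈ Matrix.unitaryGroup n ℂ →
      B * V = V * Matrix.diagonal (fun j => (b j : ℂ)) →
      ‖B - Matrix.diagonal (fun i => (a i : ℂ))‖ < δ →
      ∀ i k j, |dslope f (a i) (b j) - dslope f (a i) (a k)| * ‖V k j‖ ≤ ε := by
  have hcont : ∀ i m, ContinuousAt (dslope f (a i)) (a m) := fun i m => by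
    by_cases h : a m = a i
    · rw [h]; exact continuousAt_dslope_same.2 (hf i)
    · exact (continuousAt_dslope_of_ne h).2 (hf m).continuousAt
  -- The bound ε serves when b j is near a k; the bound 1 gives a crude estimate of the divided
  -- difference in the other case.
  have hmin : 0 < min ε 1 := lt_min hε one_pos
  have : ∀ᶠ η in 𝓝[>] (0 : ℝ), ∀ i m, ∀ x, |x - a m| < η →
      |dslope f (a i) x - dslope f (a i) (a m)| < min ε 1 := by
    refine eventually_all.2 fun i => eventually_all.2 fun m => ?_
    obtain ⟨η, hη, h⟩ := Metric.continuousAt_iff.1 (hcont i m) _ hmin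
    filter_upwards [Ioo_mem_nhdsGT hη] with t ht x hx
    exact h (hx.trans ht.2)
  obtain ⟨η, hη, hη0⟩ := (this.and self_mem_nhdsWithin).exists
  have hη0 : 0 < η := hη0
  set C : ℝ := ∑ i, ∑ m, |dslope f (a i) (a m)| with hC
  have hCb : ∀ i m, |dslope f (a i) (a m)| ≤ C := fun i m =>
    (Finset.single_le_sum (f := fun m => |dslope f (a i) (a m)|) (fun _ _ => abs_nonneg _)
      (Finset.mem_univ m)).trans (Finset.single_le_sum
      (f := fun i => ∑ m, |dslope f (a i) (a m)|)
      (fun _ _ => Finset.sum_nonneg fun _ _ => abs_nonneg _) (Finset.mem_univ i))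
  have hC0 : 0 ≤ C := Finset.sum_nonneg fun _ _ => Finset.sum_nonneg fun _ _ => abs_nonneg _
  set R : ℝ := (Fintype.card n : ℝ) with hR
  have hR0 : 0 ≤ R := Nat.cast_nonneg _
  -- The first bound puts every b j within η of some a m; the second makes the eigenvector
  -- coordinate V k j small when b j is far from a k.
  refine ⟨min (η / (R ^ 2 + 1)) (ε * η / ((1 + 2 * C) * (R + 1))), by positivity, ?_⟩
  intro B V b hV hBV hB i k j
  set K := B - Matrix.diagonal (fun i => (a i : ℂ)) with hK
  have hKV : ∀ m, ‖(K * V) m j‖ ≤ R * ‖K‖ := fun m => by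
    rw [Matrix.mul_apply]
    refine (norm_sum_le _ _).trans ?_
    rw [hR, ← nsmul_eq_mul, ← Finset.card_univ, ← Finset.sum_const]
    refine Finset.sum_le_sum fun l _ => ?_
    rw [norm_mul]
    exact (mul_le_mul (norm_entry_le_frobenius K m l) (unitary_entry_norm_le hV l j)
      (norm_nonneg _) (norm_nonneg _)).trans (mul_one _).le
  have hdiff : ∀ m, |b j - a m| * ‖V m j‖ ≤ R * ‖K‖ := fun m => by
    refine le_trans (le_of_eq ?_) (hKV m)
    rw [hK, Matrix.sub_mul, hBV, Matrix.sub_apply, Matrix.mul_diagonal, Matrix.diagonal_mul,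
      mul_comm (V m j), ← sub_mul, norm_mul, ← Complex.ofReal_sub, Complex.norm_real,
      Real.norm_eq_abs]
  by_cases hk : |b j - a k| < η
  · have h1 := (hη i k _ hk).le.trans (min_le_left _ _)
    calc _ ≤ ε * 1 := mul_le_mul h1 (unitary_entry_norm_le hV k j) (norm_nonneg _) hε.le
      _ = ε := mul_one _
  · push Not at hk
    have hB1 : ‖K‖ * (R ^ 2 + 1) < η := (lt_div_iff₀ (by positivity)).1 (lt_min_iff.1 hB).1
    have hB2 : ‖K‖ * ((1 + 2 * C) * (R + 1)) < ε * η :=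
      (lt_div_iff₀ (by positivity)).1 (lt_min_iff.1 hB).2
    have hKn := norm_nonneg K
    -- A unit column has a coordinate of modulus at least 1 / R; with `hdiff` this forces b j to lie
    -- close to the corresponding a m.
    obtain ⟨m, hm⟩ : ∃ m, 1 ≤ R * ‖V m j‖ := by
      by_contra! hcon
      have hs : ∑ m, R * ‖V m j‖ ^ 2 = R := by
        rw [← Finset.mul_sum, unitary_col_norm_sq_sum hV j, mul_one]
      have hs2 : ∑ m, R * ‖V m j‖ ^ 2 < ∑ _m : n, (1 : ℝ) := by
        refine Finset.sum_lt_sum_of_nonempty ⟨j, Finset.mem_univ j⟩ fun m _ => ?_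
        have := unitary_entry_norm_le hV m j
        have h0 := norm_nonneg (V m j)
        nlinarith [hcon m, mul_nonneg hR0 h0]
      rw [hs] at hs2
      simp [hR] at hs2
    have hm' : |b j - a m| < η := by
      have h1 := hdiff m
      have h2 : |b j - a m| * 1 ≤ |b j - a m| * (R * ‖V m j‖) := by gcongr
      nlinarith
    have hD : |dslope f (a i) (b j) - dslope f (a i) (a k)| ≤ 1 + 2 * C := by
      have h1 := (hη i m _ hm').le.trans (min_le_right _ _)
      have h2 := hCb i m
      have h3 := hCb i k
      rw [abs_le] at *
      constructor <;> linarith [h1.1, h1.2, h2.1, h2.2, h3.1, h3.2]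
    have hVk : η * ‖V k j‖ ≤ R * ‖K‖ :=
      (mul_le_mul_of_nonneg_right hk (norm_nonneg _)).trans (hdiff k)
    have h1 : η * (|dslope f (a i) (b j) - dslope f (a i) (a k)| * ‖V k j‖) ≤
        (1 + 2 * C) * (R * ‖K‖) := by
      calc _ = |dslope f (a i) (b j) - dslope f (a i) (a k)| * (η * ‖V k j‖) := by ring
        _ ≤ _ := mul_le_mul hD hVk (by positivity) (by positivity)
    have h2 : (1 + 2 * C) * (R * ‖K‖) ≤ η * ε := by nlinarith [mul_nonneg hC0 hKn]
    exact le_of_mul_le_mul_left (h1.trans h2) hη0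

/-- Entrywise multiplication by a fixed matrix, as a real continuous linear map. -/
def schurCLM (M : Matrix n n ℂ) : Matrix n n ℂ →L[ℝ] Matrix n n ℂ :=
  LinearMap.toContinuousLinearMap
    { toFun := fun X => Matrix.of fun i j => M i j * X i j
      map_add' := fun X Y => by ext i j; simp [mul_add]
      map_smul' := fun c X => by ext i j; simp [mul_left_comm] }

@[simp] lemma schurCLM_apply (M X : Matrix n n ℂ) (i j : n) :
    schurCLM M X i j = M i j * X i j := rfl

/-- The Daletskii–Krein formula at a real diagonal matrix. -/
lemma hasFDerivWithinAt_cfc_diagonal (f : ℝ → ℝ) (a : n → ℝ)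
    (hf : ∀ i, DifferentiableAt ℝ f (a i)) :
    HasFDerivWithinAt (fun B : Matrix n n ℂ => cfc f B)
      (schurCLM (Matrix.of fun i j => ((dslope f (a i) (a j) : ℝ) : ℂ)))
      {B | B.IsHermitian} (Matrix.diagonal (fun i => (a i : ℂ))) := by
  obtain ⟨C, hC, hCn⟩ := exists_frobenius_le (n := n)
  refine hasFDerivWithinAt_iff_isLittleO.2 (Asymptotics.isLittleO_iff.2 ?_)
  intro c hc
  set R : ℝ := (Fintype.card n : ℝ) with hR
  have hR0 : 0 ≤ R := Nat.cast_nonneg _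
  obtain ⟨δ, hδ, H⟩ := exists_dslope_sub_mul_le f a hf (ε := c / (C * (R ^ 2 + 1))) (by positivity)
  have hball : ∀ᶠ B in 𝓝[{B | B.IsHermitian}] (Matrix.diagonal (fun i => (a i : ℂ))),
      ‖B - Matrix.diagonal (fun i => (a i : ℂ))‖ < δ := by
    apply mem_nhdsWithin_of_mem_nhds
    filter_upwards [Metric.ball_mem_nhds _ hδ] with B hB
    rwa [← dist_eq_norm]
  filter_upwards [hball, self_mem_nhdsWithin] with B hB hBh
  obtain ⟨V, hV, b, hb, hfb⟩ := isHermitian_exists_diagonalization hBh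
  have H := H B V b hV hb hB
  set K := B - Matrix.diagonal (fun i => (a i : ℂ)) with hK
  set X := cfc f B - cfc f (Matrix.diagonal (fun i => (a i : ℂ))) -
    schurCLM (Matrix.of fun i j => ((dslope f (a i) (a j) : ℝ) : ℂ)) K with hX
  have hKV : ∀ i j, ((b j - a i : ℝ) : ℂ) * V i j = ∑ k, K i k * V k j := fun i j => by
    rw [← Matrix.mul_apply, hK, Matrix.sub_mul, hb, Matrix.sub_apply, Matrix.mul_diagonal,
      Matrix.diagonal_mul]
    push_cast; ring
  -- Since f (b j) - f (a i) is the divided difference times b j - a i, `hKV` turns the increment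
  -- into a sum over K i k. Subtracting the Schur product leaves only differences of divided
  -- differences, weighted by V k j.
  have hXV : ∀ i j, (X * V) i j = ∑ k, K i k *
      (((dslope f (a i) (b j) - dslope f (a i) (a k) : ℝ) : ℂ) * V k j) := fun i j => by
    rw [hX, Matrix.sub_mul, Matrix.sub_mul, hfb, cfc_diagonal_ofReal, Matrix.sub_apply,
      Matrix.sub_apply, Matrix.mul_diagonal, Matrix.diagonal_mul, Matrix.mul_apply,
      mul_comm (V i j), ← sub_mul, ← Complex.ofReal_sub, ← sub_smul_dslope, smul_eq_mul, mul_comm (b j - a i),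
      Complex.ofReal_mul, mul_assoc, hKV, Finset.mul_sum, ← Finset.sum_sub_distrib]
    refine Finset.sum_congr rfl fun k _ => ?_
    simp only [schurCLM_apply, Matrix.of_apply]
    push_cast; ring
  have hXVn : ∀ i j, ‖(X * V) i j‖ ≤ R * (‖K‖ * (c / (C * (R ^ 2 + 1)))) := fun i j => by
    rw [hXV]
    refine (norm_sum_le _ _).trans ?_
    rw [hR, ← nsmul_eq_mul, ← Finset.card_univ, ← Finset.sum_const]
    refine Finset.sum_le_sum fun k _ => ?_
    rw [norm_mul, norm_mul, Complex.norm_real, Real.norm_eq_abs]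
    exact mul_le_mul (norm_entry_le_frobenius K i k) (H i k j) (by positivity) (norm_nonneg _)
  have hXe : X = X * V * star V := by
    rw [Matrix.mul_assoc, Matrix.mem_unitaryGroup_iff.1 hV, Matrix.mul_one]
  have hXn : ∀ i j, ‖X i j‖ ≤ R * (R * (‖K‖ * (c / (C * (R ^ 2 + 1))))) := fun i j => by
    rw [hXe, Matrix.mul_apply]
    refine (norm_sum_le _ _).trans ?_
    nth_rw 1 [hR]
    rw [← nsmul_eq_mul, ← Finset.card_univ, ← Finset.sum_const]
    refine Finset.sum_le_sum fun k _ => ?_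
    rw [norm_mul, Matrix.star_apply, norm_star]
    exact (mul_le_mul (hXVn i k) (unitary_entry_norm_le hV j k) (norm_nonneg _)
      (by positivity)).trans (mul_one _).le
  refine (hCn X _ (by positivity) hXn).trans ?_
  have : C * (R * (R * (‖K‖ * (c / (C * (R ^ 2 + 1)))))) = R ^ 2 / (R ^ 2 + 1) * (c * ‖K‖) := by
    field_simp
  rw [this]
  have h1 : R ^ 2 / (R ^ 2 + 1) ≤ 1 := by
    rw [div_le_one (by positivity)]; linarith
  exact mul_le_of_le_one_left (by positivity) h1

end FunctionalCalculus

end AluthgeStable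

namespace AluthgeStable

open Filter Topology
open scoped ComplexOrder

set_option linter.unusedSectionVars false

/-! ### Derivative of the powers of the modulus and of the Aluthge transform -/

section AbsPow

attribute [local instance] Matrix.frobeniusNormedRing Matrix.frobeniusNormedAlgebra

variable {n : Type*} [Fintype n] [DecidableEq n]

lemma conjTranspose_mul_self_diagonal (d : n → ℂ) :
    (Matrix.diagonal d)ᴴ * Matrix.diagonal d =
      Matrix.diagonal (fun i => ((‖d i‖ ^ 2 : ℝ) : ℂ)) := by
  rw [Matrix.diagonal_conjTranspose, Matrix.diagonal_mul_diagonal]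
  congr 1
  ext i
  simp [RCLike.conj_mul]

/-- The conjugate transpose as a real continuous linear map. -/
def conjTransposeCLM : Matrix n n ℂ →L[ℝ] Matrix n n ℂ :=
  LinearMap.toContinuousLinearMap
    { toFun := fun X => Xᴴ
      map_add' := fun X Y => Matrix.conjTranspose_add X Y
      map_smul' := fun c X => by simp }

@[simp] lemma conjTransposeCLM_apply (X : Matrix n n ℂ) : conjTransposeCLM X = Xᴴ := rfl

/-- The product rule for matrix valued maps. -/
lemma exists_hasFDerivAt_mul {F G : Matrix n n ℂ → Matrix n n ℂ}
    {F' G' : Matrix n n ℂ →L[ℝ] Matrix n n ℂ} {T : Matrix n n ℂ}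
    (hF : HasFDerivAt F F' T) (hG : HasFDerivAt G G' T) :
    ∃ L : Matrix n n ℂ →L[ℝ] Matrix n n ℂ, HasFDerivAt (fun T => F T * G T) L T ∧
      ∀ A, L A = F T * G' A + F' A * G T :=
  ⟨_, HasFDerivAt.mul' hF hG, fun A => by rfl⟩

/-- Chain rule through T ↦ T* T. Its values are Hermitian, so a derivative of the functional
calculus within the Hermitian matrices suffices; invertibility keeps x ^ (s / 2) differentiable at
the eigenvalues. -/
lemma exists_hasFDerivAt_absPow_diagonal {r : ℕ} (s : ℝ) (d : Fin r → ℂ) (hd : ∀ i, d i ≠ 0) :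
    ∃ L : Matrix (Fin r) (Fin r) ℂ →L[ℝ] Matrix (Fin r) (Fin r) ℂ,
      HasFDerivAt (fun T => absPow T s) L (Matrix.diagonal d) ∧
      ∀ A i j, L A i j =
        ((dslope (fun x : ℝ => x ^ (s / 2)) (‖d i‖ ^ 2) (‖d j‖ ^ 2) : ℝ) : ℂ) *
          (star (d i) * A i j + star (A j i) * d j) := by
  obtain ⟨L, hL, hLA⟩ := exists_hasFDerivAt_mul
    (conjTransposeCLM.hasFDerivAt (x := Matrix.diagonal d)) (hasFDerivAt_id (Matrix.diagonal d))
  have hf : ∀ i, DifferentiableAt ℝ (fun x : ℝ => x ^ (s / 2)) (‖d i‖ ^ 2) := fun i =>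
    Real.differentiableAt_rpow_const_of_ne _ (by simpa using hd i)
  have hK := hasFDerivWithinAt_cfc_diagonal _ _ hf
  rw [← conjTranspose_mul_self_diagonal d] at hK
  refine ⟨_, (HasFDerivWithinAt.comp (Matrix.diagonal d)
    (f := fun T : Matrix (Fin r) (Fin r) ℂ => conjTransposeCLM T * id T) (s := Set.univ) hK
    hL.hasFDerivWithinAt (fun T _ => Matrix.isHermitian_conjTranspose_mul_self T)).hasFDerivAt univ_mem, ?_⟩
  intro A i j
  have hLe : L A i j = star (d i) * A i j + star (A j i) * d j := by
    rw [hLA]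
    simp [Matrix.diagonal_conjTranspose, Matrix.diagonal_mul, Matrix.mul_diagonal]
  rw [← hLe]
  rfl

lemma absPow_diagonal {r : ℕ} (s : ℝ) (d : Fin r → ℂ) :
    absPow (Matrix.diagonal d) s = Matrix.diagonal (fun i => ((‖d i‖ ^ s : ℝ) : ℂ)) := by
  rw [absPow, conjTranspose_mul_self_diagonal, cfc_diagonal_ofReal]
  congr 1
  ext i
  rw [← Real.rpow_natCast, ← Real.rpow_mul (norm_nonneg _)]
  norm_num [mul_div_cancel₀]

lemma spectrum_real_finite (T : Matrix n n ℂ) : (spectrum ℝ (Tᴴ * T)).Finite :=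
  (Matrix.finite_real_spectrum (A := Tᴴ * T))

/-- The powers |T|^(-1) and |T|^(1-l) merge, leaving only two factors to differentiate. For singular
T this survives because `0 ^ x = 0` for x ≠ 0, whence the condition on l. -/
lemma aluthge_eq {r : ℕ} {l : ℝ} (hl : l ≠ 0) (T : Matrix (Fin r) (Fin r) ℂ) :
    aluthge l T = absPow T l * T * absPow T (-l) := by
  have hc : ∀ f : ℝ → ℝ, ContinuousOn f (spectrum ℝ (Tᴴ * T)) := fun f =>
    (spectrum_real_finite T).continuousOn f
  rw [aluthge, polarFactor, Matrix.mul_assoc, Matrix.mul_assoc, Matrix.mul_assoc]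
  congr 2
  rw [absPow, absPow, absPow, ← cfc_mul _ _ _ (hc _) (hc _)]
  refine cfc_congr fun x hx => ?_
  have hx0 : 0 ≤ x := by
    have hps := Matrix.posSemidef_conjTranspose_mul_self T
    rw [hps.1.spectrum_real_eq_range_eigenvalues] at hx
    obtain ⟨i, hi⟩ := hx
    exact hi ▸ hps.eigenvalues_nonneg i
  have : -l / 2 = -1 / 2 + (1 - l) / 2 := by ring
  rw [this, Real.rpow_add' hx0]
  rw [← this]
  exact div_ne_zero (neg_ne_zero.2 hl) two_ne_zero

/-- This is 1/B - 1/A = -(B - A)/(AB), with its limit on the diagonal; it expresses the derivatives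
of |T|^l and |T|^(-l) by the same divided differences. -/
lemma dslope_rpow_neg (s : ℝ) {a b : ℝ} (ha : 0 < a) (hb : 0 < b) :
    dslope (fun x : ℝ => x ^ (-s)) a b =
      -(dslope (fun x : ℝ => x ^ s) a b) * a ^ (-s) * b ^ (-s) := by
  have ha' := (Real.rpow_pos_of_pos ha s).ne'
  have hb' := (Real.rpow_pos_of_pos hb s).ne'
  by_cases h : b = a
  · subst h
    rw [dslope_same, dslope_same, Real.deriv_rpow_const, Real.deriv_rpow_const,
      show -s - 1 = (s - 1) + (-s) + (-s) by ring, Real.rpow_add hb, Real.rpow_add hb]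
    ring
  · rw [dslope_of_ne _ h, dslope_of_ne _ h, slope_def_field, slope_def_field, Real.rpow_neg ha.le,
      Real.rpow_neg hb.le]
    have := sub_ne_zero.2 h
    field_simp
    ring

/-- The derivative of the Aluthge transform at an invertible diagonal matrix. -/
lemma exists_hasFDerivAt_aluthge_diagonal {r : ℕ} {l : ℝ} (hl : l ≠ 0) (d : Fin r → ℂ)
    (hd : ∀ i, d i ≠ 0) :
    ∃ L : Matrix (Fin r) (Fin r) ℂ →L[ℝ] Matrix (Fin r) (Fin r) ℂ,
      HasFDerivAt (aluthge l) L (Matrix.diagonal d) ∧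
      ∀ A i j, L A i j = ((‖d j‖ ^ (-l) : ℝ) : ℂ) * (((‖d i‖ ^ l : ℝ) : ℂ) * A i j +
        ((dslope (fun x : ℝ => x ^ (l / 2)) (‖d i‖ ^ 2) (‖d j‖ ^ 2) : ℝ) : ℂ) * (d j - d i) *
          (star (d i) * A i j + star (A j i) * d j)) := by
  obtain ⟨L₁, h₁, e₁⟩ := exists_hasFDerivAt_absPow_diagonal l d hd
  obtain ⟨L₂, h₂, e₂⟩ := exists_hasFDerivAt_absPow_diagonal (-l) d hd
  obtain ⟨L₃, h₃, e₃⟩ := exists_hasFDerivAt_mul h₁ (hasFDerivAt_id (Matrix.diagonal d))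
  obtain ⟨L, h, e⟩ := exists_hasFDerivAt_mul h₃ h₂
  refine ⟨L, ?_, fun A i j => ?_⟩
  · have : aluthge (r := r) l = fun T => absPow T l * id T * absPow T (-l) :=
      funext fun T => aluthge_eq hl T
    rwa [this]
  · have hp : ∀ i, 0 < ‖d i‖ := fun i => norm_pos_iff.2 (hd i)
    have hq : ∀ i, (‖d i‖ ^ 2) ^ (-(l / 2)) = ‖d i‖ ^ (-l) := fun i => by
      rw [← Real.rpow_natCast, ← Real.rpow_mul (hp i).le]
      congr 1
      push_cast; ring
    have hi : ((‖d i‖ ^ l : ℝ) : ℂ) * ((‖d i‖ ^ (-l) : ℝ) : ℂ) = 1 := by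
      rw [← Complex.ofReal_mul, ← Real.rpow_add (hp i)]; simp
    have hneg := dslope_rpow_neg (l / 2) (pow_pos (hp i) 2) (pow_pos (hp j) 2)
    rw [hq, hq, ← neg_div] at hneg
    rw [e, e₃, absPow_diagonal, absPow_diagonal]
    simp only [id, ContinuousLinearMap.coe_id', Matrix.add_mul, Matrix.add_apply, Matrix.diagonal_mul, Matrix.mul_diagonal,
      Matrix.diagonal_mul_diagonal, e₁, e₂, hneg]
    push_cast at hi ⊢
    linear_combination (-(d i) * (dslope (fun x : ℝ => x ^ (l / 2)) (‖d i‖ ^ 2) (‖d j‖ ^ 2) : ℝ) *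
      ((‖d j‖ ^ (-l) : ℝ) : ℂ) * (star (d i) * A i j + star (A j i) * d j)) * hi

end AbsPow

end AluthgeStable

namespace AluthgeStable

open Polynomial

/-! ### Tangent spaces of the two orbits at a diagonal matrix -/

section TangentSpaces

attribute [local instance] Matrix.frobeniusNormedRing Matrix.frobeniusNormedAlgebra

variable {r : ℕ}

lemma unitaryOrbit_subset_similarityOrbit (D : Matrix (Fin r) (Fin r) ℂ) :
    unitaryOrbit D ⊆ similarityOrbit D := by
  rintro T ⟨U, hU, rfl⟩
  exact ⟨Unitary.toUnits ⟨U, hU⟩, rfl⟩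

/-- The tangent space at `diagonal d` of its similarity orbit. -/
def similarityTangent (d : Fin r → ℂ) : Submodule ℝ (Matrix (Fin r) (Fin r) ℂ) where
  carrier := {X | ∀ i j, d i = d j → X i j = 0}
  zero_mem' := by simp
  add_mem' := fun hX hY i j h => by simp [hX i j h, hY i j h]
  smul_mem' := fun c X hX i j h => by simp [hX i j h]

/-- The tangent space at `diagonal d` of its unitary orbit. -/
def unitaryTangent (d : Fin r → ℂ) : Submodule ℝ (Matrix (Fin r) (Fin r) ℂ) where
  carrier := {X | (∀ i j, d i = d j → X i j = 0) ∧
    ∀ i j, X i j * star (d j - d i) = (d j - d i) * star (X j i)}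
  zero_mem' := by simp
  add_mem' := fun {X Y} hX hY => ⟨fun i j h => by simp [hX.1 i j h, hY.1 i j h], fun i j => by
    rw [Matrix.add_apply, Matrix.add_apply, star_add, add_mul, mul_add, hX.2, hY.2]⟩
  smul_mem' := fun c X hX => ⟨fun i j h => by simp [hX.1 i j h], fun i j => by
    rw [Matrix.smul_apply, Matrix.smul_apply, star_smul, smul_mul_assoc, hX.2, mul_smul_comm,
      star_trivial c]⟩

lemma mem_similarityTangent {d : Fin r → ℂ} {X : Matrix (Fin r) (Fin r) ℂ} :
    X ∈ similarityTangent d ↔ ∀ i j, d i = d j → X i j = 0 := Iff.rfl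

lemma mem_unitaryTangent {d : Fin r → ℂ} {X : Matrix (Fin r) (Fin r) ℂ} :
    X ∈ unitaryTangent d ↔ (∀ i j, d i = d j → X i j = 0) ∧
      ∀ i j, X i j * star (d j - d i) = (d j - d i) * star (X j i) := Iff.rfl

/-- The solution `Y` of `Y D - D Y = X` with `D = diagonal d`. -/
def commutatorPreimage (d : Fin r → ℂ) (X : Matrix (Fin r) (Fin r) ℂ) :
    Matrix (Fin r) (Fin r) ℂ := Matrix.of fun i j => X i j / (d j - d i)

lemma commutatorPreimage_spec {d : Fin r → ℂ} {X : Matrix (Fin r) (Fin r) ℂ}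
    (hX : X ∈ similarityTangent d) :
    commutatorPreimage d X * Matrix.diagonal d - Matrix.diagonal d * commutatorPreimage d X = X := by
  ext i j
  rw [Matrix.sub_apply, Matrix.mul_diagonal, Matrix.diagonal_mul, commutatorPreimage,
    Matrix.of_apply]
  by_cases h : d i = d j
  · rw [hX i j h, h]; simp
  · have : d j - d i ≠ 0 := sub_ne_zero.2 (Ne.symm h)
    field_simp

/-- The second condition in `unitaryTangent` is skewness of the preimage with denominators cleared.
Where d i = d j the preimage is 0, division by zero being 0. -/
lemma star_commutatorPreimage {d : Fin r → ℂ} {X : Matrix (Fin r) (Fin r) ℂ}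
    (hX : X ∈ unitaryTangent d) :
    star (commutatorPreimage d X) = -commutatorPreimage d X := by
  ext i j
  rw [Matrix.star_apply, Matrix.neg_apply, commutatorPreimage, Matrix.of_apply, Matrix.of_apply,
    star_div₀]
  by_cases h : d i = d j
  · simp [h]
  · have h1 : d j - d i ≠ 0 := sub_ne_zero.2 (Ne.symm h)
    have h2 : star (d i - d j) ≠ 0 := star_ne_zero.2 (sub_ne_zero.2 h)
    have h3 := hX.2 i j
    have h4 : star (d j - d i) = -star (d i - d j) := by rw [← star_neg, neg_sub]
    rw [h4] at h3
    rw [← neg_div, div_eq_div_iff h2 h1]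
    linear_combination -h3

lemma contDiff_exp_conj (Y D : Matrix (Fin r) (Fin r) ℂ) :
    ContDiff ℝ ∞ (fun t : ℝ => NormedSpace.exp (t • Y) * D * NormedSpace.exp (-(t • Y))) := by
  have h : ContDiff ℝ ∞ (NormedSpace.exp : Matrix (Fin r) (Fin r) ℂ → Matrix (Fin r) (Fin r) ℂ) :=
    contDiff_iff_contDiffAt.2 fun x => (NormedSpace.exp_analytic (𝕂 := ℝ) x).contDiffAt
  have h1 : ContDiff ℝ ∞ (fun t : ℝ => t • Y) := contDiff_id.smul contDiff_const
  exact ((h.comp h1).mul contDiff_const).mul (h.comp h1.neg)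

lemma hasDerivAt_exp_conj (Y D : Matrix (Fin r) (Fin r) ℂ) :
    HasDerivAt (fun t : ℝ => NormedSpace.exp (t • Y) * D * NormedSpace.exp (-(t • Y)))
      (Y * D - D * Y) 0 := by
  have h1 : HasDerivAt (fun t : ℝ => NormedSpace.exp (t • Y)) Y 0 := by
    have h := hasDerivAt_exp_smul_const (𝕂 := ℝ) Y (0 : ℝ)
    rw [zero_smul, NormedSpace.exp_zero, one_mul] at h
    exact h
  have h2 : HasDerivAt (fun t : ℝ => NormedSpace.exp (-(t • Y))) (-Y) 0 := by
    have h := hasDerivAt_exp_smul_const (𝕂 := ℝ) (-Y) (0 : ℝ)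
    simp only [zero_smul, neg_zero, NormedSpace.exp_zero, one_mul, smul_neg] at h
    exact h
  have h3 := (h1.mul (hasDerivAt_const (0 : ℝ) D)).mul h2
  have he : Y * D - D * Y = (Y * D + NormedSpace.exp ((0 : ℝ) • Y) * 0) *
      NormedSpace.exp (-((0 : ℝ) • Y)) + NormedSpace.exp ((0 : ℝ) • Y) * D * -Y := by
    simp [sub_eq_add_neg]
  rw [he]
  exact h3

lemma exp_conj_mem_similarityOrbit (Y D : Matrix (Fin r) (Fin r) ℂ) (t : ℝ) :
    NormedSpace.exp (t • Y) * D * NormedSpace.exp (-(t • Y)) ∈ similarityOrbit D := by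
  obtain ⟨S, hS⟩ := Matrix.isUnit_exp (t • Y)
  refine ⟨S, ?_⟩
  rw [Matrix.exp_neg, ← hS, Matrix.coe_units_inv]

lemma exp_conj_mem_unitaryOrbit {Y : Matrix (Fin r) (Fin r) ℂ} (hY : star Y = -Y)
    (D : Matrix (Fin r) (Fin r) ℂ) (t : ℝ) :
    NormedSpace.exp (t • Y) * D * NormedSpace.exp (-(t • Y)) ∈ unitaryOrbit D := by
  have h : (NormedSpace.exp (t • Y))ᴴ = NormedSpace.exp (-(t • Y)) := by
    rw [← Matrix.exp_conjTranspose, ← Matrix.star_eq_conjTranspose, star_smul, hY, star_trivial,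
      smul_neg]
  refine ⟨NormedSpace.exp (t • Y), ?_, by rw [h]⟩
  rw [Matrix.mem_unitaryGroup_iff, Matrix.star_eq_conjTranspose, h, Matrix.exp_neg,
    Matrix.mul_nonsing_inv]
  exact (Matrix.isUnit_iff_isUnit_det _).1 (Matrix.isUnit_exp _)

lemma aeval_units_conj (S : (Matrix (Fin r) (Fin r) ℂ)ˣ) (D : Matrix (Fin r) (Fin r) ℂ)
    (p : ℂ[X]) :
    aeval ((S : Matrix (Fin r) (Fin r) ℂ) * D * (S⁻¹).val) p = S * aeval D p * (S⁻¹).val := by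
  rw [aeval_eq_sum_range, aeval_eq_sum_range, Finset.mul_sum, Finset.sum_mul]
  refine Finset.sum_congr rfl fun k _ => ?_
  rw [Units.conj_pow]
  simp

lemma aeval_diagonal (d : Fin r → ℂ) (p : ℂ[X]) :
    aeval (Matrix.diagonal d) p = Matrix.diagonal (fun i => p.eval (d i)) := by
  have h := aeval_algHom_apply (Matrix.diagonalAlgHom (n := Fin r) (α := ℂ) ℂ) d p
  rw [Matrix.diagonalAlgHom_apply, Matrix.diagonalAlgHom_apply] at h
  rw [h]
  congr 1
  ext i
  rw [aeval_pi_apply₂, ← coe_aeval_eq_eval]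

lemma differentiableAt_aeval {γ : ℝ → Matrix (Fin r) (Fin r) ℂ} {t : ℝ}
    (hγ : DifferentiableAt ℝ γ t) (p : ℂ[X]) :
    DifferentiableAt ℝ (fun t => aeval (γ t) p) t := by
  simp_rw [aeval_eq_sum_range]
  refine DifferentiableAt.fun_sum fun k _ => ?_
  exact DifferentiableAt.const_smul (hγ.pow k) ((p.coeff k : ℂ))

/-- The velocity of a curve of matrices similar to `diagonal d` has no component commuting with
`diagonal d`. -/
lemma velocity_mem_similarityTangent {d : Fin r → ℂ} {γ : ℝ → Matrix (Fin r) (Fin r) ℂ}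
    {v : Matrix (Fin r) (Fin r) ℂ} (hγ : HasDerivAt γ v 0) (h0 : γ 0 = Matrix.diagonal d)
    (hmem : ∀ t, γ t ∈ similarityOrbit (Matrix.diagonal d)) : v ∈ similarityTangent d := by
  intro i j hij
  -- (X - d i) q annihilates the whole orbit. Differentiating along γ at 0, the term with D - d i
  -- has zero i-th row, so v i j * q (d j) = 0; and q (d i) ≠ 0, as the other eigenvalues in the
  -- product are distinct from d i.
  set q : ℂ[X] := ∏ μ ∈ (Finset.univ.image d).erase (d i), (X - C μ) with hq
  have hm : ∀ t, (γ t - d i • (1 : Matrix (Fin r) (Fin r) ℂ)) * aeval (γ t) q = 0 := fun t => by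
    have h1 : aeval (γ t) ((X - C (d i)) * q) = 0 := by
      obtain ⟨S, hS⟩ := hmem t
      rw [hS, aeval_units_conj, aeval_diagonal]
      have : (fun k => ((X - C (d i)) * q).eval (d k)) = 0 := by
        ext k
        rw [hq, Finset.mul_prod_erase (Finset.univ.image d) (fun μ => X - C μ)
          (Finset.mem_image_of_mem d (Finset.mem_univ i)), eval_prod]
        exact Finset.prod_eq_zero (Finset.mem_image_of_mem d (Finset.mem_univ k)) (by simp)
      rw [this]
      simp
    simpa [Algebra.algebraMap_eq_smul_one] using h1
  have hd1 : HasDerivAt (fun t => γ t - d i • (1 : Matrix (Fin r) (Fin r) ℂ)) v 0 :=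
    hγ.sub_const _
  have hd2 := (differentiableAt_aeval hγ.differentiableAt q).hasDerivAt
  have hd := hd1.mul hd2
  have hz : HasDerivAt (fun _ : ℝ => (0 : Matrix (Fin r) (Fin r) ℂ)) 0 0 := hasDerivAt_const _ _
  have hfun : (fun t => γ t - d i • (1 : Matrix (Fin r) (Fin r) ℂ)) * (fun t => aeval (γ t) q) =
      fun _ => 0 := funext hm
  rw [hfun] at hd
  have he := congrFun (congrFun (hd.unique hz) i) j
  rw [h0, aeval_diagonal, Matrix.add_apply, Matrix.mul_diagonal, Matrix.smul_one_eq_diagonal,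
    Matrix.diagonal_sub, Matrix.diagonal_mul, sub_self, zero_mul, add_zero, Matrix.zero_apply,
    ← hij] at he
  refine (mul_eq_zero.1 he).resolve_right ?_
  rw [hq, eval_prod]
  refine Finset.prod_ne_zero_iff.2 fun μ hμ => ?_
  rw [eval_sub, eval_X, eval_C]
  exact sub_ne_zero.2 (Finset.ne_of_mem_erase hμ).symm

lemma velocity_mem_unitaryTangent {d : Fin r → ℂ} {γ : ℝ → Matrix (Fin r) (Fin r) ℂ}
    {v : Matrix (Fin r) (Fin r) ℂ} (hγ : HasDerivAt γ v 0) (h0 : γ 0 = Matrix.diagonal d)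
    (hmem : ∀ t, γ t ∈ unitaryOrbit (Matrix.diagonal d)) : v ∈ unitaryTangent d := by
  refine ⟨velocity_mem_similarityTangent hγ h0
    fun t => unitaryOrbit_subset_similarityOrbit _ (hmem t), fun i j => ?_⟩
  have hstar : HasDerivAt (fun t => star (γ t)) (star v) 0 := hγ.star
  have h1 := hγ.mul hstar
  have h2 := hstar.mul hγ
  -- Every point of the unitary orbit is normal; the derivative of this identity at 0 is the
  -- required relation between v i j and v j i.
  have hfun : (γ * fun t => star (γ t)) = (fun t => star (γ t)) * γ := by
    funext t
    simp only [Pi.mul_apply]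
    obtain ⟨U, hU, h⟩ := hmem t
    have hUU : Uᴴ * U = 1 := Matrix.mem_unitaryGroup_iff'.1 hU
    rw [h, Matrix.star_eq_conjTranspose, Matrix.conjTranspose_mul, Matrix.conjTranspose_mul,
      Matrix.conjTranspose_conjTranspose]
    simp only [Matrix.mul_assoc]
    rw [← Matrix.mul_assoc Uᴴ U, ← Matrix.mul_assoc Uᴴ U, hUU, Matrix.one_mul, Matrix.one_mul,
      ← Matrix.mul_assoc (Matrix.diagonal d), ← Matrix.mul_assoc (Matrix.diagonal d)ᴴ,
      Matrix.diagonal_conjTranspose, Matrix.diagonal_mul_diagonal, Matrix.diagonal_mul_diagonal]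
    simp_rw [mul_comm]
  rw [hfun] at h1
  have he := congrFun (congrFun (h1.unique h2) i) j
  rw [h0, Matrix.star_eq_conjTranspose (Matrix.diagonal d), Matrix.diagonal_conjTranspose,
    Matrix.add_apply, Matrix.add_apply, Matrix.mul_diagonal, Matrix.diagonal_mul,
    Matrix.mul_diagonal, Matrix.diagonal_mul, Matrix.star_apply] at he
  simp only [Pi.star_apply] at he
  rw [star_sub]
  linear_combination he

/-- Every candidate is a commutator [Y, D], which is the velocity of exp (tY) D exp (-tY). The same
curve, with Y skew-Hermitian, serves for the unitary orbit. -/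
theorem tangentSpaceAt_similarityOrbit (d : Fin r → ℂ) :
    tangentSpaceAt (similarityOrbit (Matrix.diagonal d)) (Matrix.diagonal d) =
      similarityTangent d := by
  apply le_antisymm
  · refine Submodule.span_le.2 ?_
    rintro v ⟨γ, hγ, hmem, h0, rfl⟩
    exact velocity_mem_similarityTangent
      ((hγ.differentiable (by simp)).differentiableAt.hasDerivAt) h0 hmem
  · intro X hX
    refine Submodule.subset_span ⟨_, contDiff_exp_conj (commutatorPreimage d X) _,
      exp_conj_mem_similarityOrbit _ _, by simp, ?_⟩
    exact (hasDerivAt_exp_conj _ _).deriv.trans (commutatorPreimage_spec hX)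

theorem tangentSpaceAt_unitaryOrbit (d : Fin r → ℂ) :
    tangentSpaceAt (unitaryOrbit (Matrix.diagonal d)) (Matrix.diagonal d) = unitaryTangent d := by
  apply le_antisymm
  · refine Submodule.span_le.2 ?_
    rintro v ⟨γ, hγ, hmem, h0, rfl⟩
    exact velocity_mem_unitaryTangent
      ((hγ.differentiable (by simp)).differentiableAt.hasDerivAt) h0 hmem
  · intro X hX
    refine Submodule.subset_span ⟨_, contDiff_exp_conj (commutatorPreimage d X) _,
      exp_conj_mem_unitaryOrbit (star_commutatorPreimage hX) _, by simp, ?_⟩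
    exact (hasDerivAt_exp_conj _ _).deriv.trans (commutatorPreimage_spec hX.1)

end TangentSpaces

end AluthgeStable

namespace AluthgeStable

/-! ### Size and parameter dependence of the coefficients -/

section Coefficients

/-- The divided difference of `x ↦ x ^ (l / 2)` at `p ^ 2` and `q ^ 2`. -/
def dividedDiff (l p q : ℝ) : ℝ := dslope (fun x : ℝ => x ^ (l / 2)) (p ^ 2) (q ^ 2)

lemma sq_rpow_half {p : ℝ} (hp : 0 < p) (l : ℝ) : (p ^ 2) ^ (l / 2) = p ^ l := by
  rw [← Real.rpow_natCast, ← Real.rpow_mul hp.le]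
  congr 1
  push_cast; ring

lemma dividedDiff_mul {l p q : ℝ} (hp : 0 < p) (hq : 0 < q) :
    dividedDiff l p q * (q ^ 2 - p ^ 2) = q ^ l - p ^ l := by
  have h := sub_smul_dslope (fun x : ℝ => x ^ (l / 2)) (p ^ 2) (q ^ 2)
  simp only [smul_eq_mul] at h
  rw [sq_rpow_half hp, sq_rpow_half hq] at h
  rw [dividedDiff, mul_comm, h]

lemma dividedDiff_comm (l p q : ℝ) : dividedDiff l p q = dividedDiff l q p := by
  rw [dividedDiff, dividedDiff]
  by_cases h : p ^ 2 = q ^ 2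
  · rw [h]
  · rw [dslope_of_ne _ h, dslope_of_ne _ (Ne.symm h), slope_comm]

lemma dividedDiff_self {l p : ℝ} (hp : 0 < p) : dividedDiff l p p = l / 2 * (p ^ l / p ^ 2) := by
  rw [dividedDiff, dslope_same, Real.deriv_rpow_const, Real.rpow_sub_one (by positivity),
    sq_rpow_half hp]

/-- The coefficient `a` for which the derivative of the Aluthge transform at `diagonal d`, restricted
to commutators `[Y, diagonal d]`, sends the entry `Y i j` to `Y i j - a * (Y i j + conj (Y j i))`. -/
def stableCoeff {r : ℕ} (l : ℝ) (d : Fin r → ℂ) (i j : Fin r) : ℂ :=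
  ((‖d j‖ ^ (-l) * dividedDiff l ‖d i‖ ‖d j‖ : ℝ) : ℂ) * (((‖d j‖ ^ 2 : ℝ) : ℂ) - star (d i) * d j)

lemma star_stableCoeff {r : ℕ} (l : ℝ) (d : Fin r → ℂ) (i j : Fin r) :
    star (stableCoeff l d j i) =
      ((‖d i‖ ^ (-l) * dividedDiff l ‖d i‖ ‖d j‖ : ℝ) : ℂ) *
        (((‖d i‖ ^ 2 : ℝ) : ℂ) - star (d i) * d j) := by
  rw [stableCoeff, star_mul', star_sub, star_mul', star_star, dividedDiff_comm]
  simp only [RCLike.star_def, Complex.conj_ofReal]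
  ring

/-- Write p = P P' and q = Q Q' with P = p^l, Q = q^l. The number equals B + φ (1/P + 1/Q) c with B
≥ 0, and the triangle inequality bounds its modulus by 1 - φ (q - p) (Q' - P'). -/
lemma norm_one_sub_lt_one_of_lt {l p q : ℝ} {c : ℂ} (hl : l ∈ Set.Ioo (0 : ℝ) 1) (hp : 0 < p)
    (hpq : p < q) (hc : ‖c‖ = p * q) :
    ‖1 - (dividedDiff l p q : ℂ) * (((q ^ (-l) : ℝ) : ℂ) * (((q ^ 2 : ℝ) : ℂ) - c) +
      ((p ^ (-l) : ℝ) : ℂ) * (((p ^ 2 : ℝ) : ℂ) - c))‖ < 1 := by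
  have hq := hp.trans hpq
  have hmul := dividedDiff_mul (l := l) hp hq
  set φ := dividedDiff l p q
  have hP : 0 < p ^ l := Real.rpow_pos_of_pos hp l
  have hQ : 0 < q ^ l := Real.rpow_pos_of_pos hq l
  have hP' : 0 < p ^ (1 - l) := Real.rpow_pos_of_pos hp _
  have hQ' : 0 < q ^ (1 - l) := Real.rpow_pos_of_pos hq _
  have hPQ : p ^ l < q ^ l := Real.rpow_lt_rpow hp.le hpq hl.1
  have hPQ' : p ^ (1 - l) < q ^ (1 - l) := Real.rpow_lt_rpow hp.le hpq (by linarith [hl.2])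
  have hpe : p = p ^ l * p ^ (1 - l) := by rw [← Real.rpow_add hp]; simp
  have hqe : q = q ^ l * q ^ (1 - l) := by rw [← Real.rpow_add hq]; simp
  rw [Real.rpow_neg hp.le, Real.rpow_neg hq.le]
  generalize p ^ l = P at *
  generalize q ^ l = Q at *
  generalize p ^ (1 - l) = P' at *
  generalize q ^ (1 - l) = Q' at *
  have hsq : 0 < q ^ 2 - p ^ 2 := by nlinarith
  have hφ : 0 < φ := by
    by_contra! h
    nlinarith
  set B : ℝ := 1 - φ * (P * P' ^ 2 + Q * Q' ^ 2) with hB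
  have hB0 : 0 ≤ B := by
    have h1 : 0 ≤ B * (q ^ 2 - p ^ 2) := by
      have : B * (q ^ 2 - p ^ 2) = P * Q * (Q' ^ 2 - P' ^ 2) := by
        rw [hB, sub_mul, mul_right_comm, hmul, hpe, hqe]; ring
      rw [this]
      have : P' ^ 2 ≤ Q' ^ 2 := by gcongr
      exact mul_nonneg (by positivity) (by linarith)
    exact nonneg_of_mul_nonneg_left h1 hsq
  have he : 1 - (φ : ℂ) * (((Q⁻¹ : ℝ) : ℂ) * (((q ^ 2 : ℝ) : ℂ) - c) +
      ((P⁻¹ : ℝ) : ℂ) * (((p ^ 2 : ℝ) : ℂ) - c)) = (B : ℂ) + ((φ * (P⁻¹ + Q⁻¹) : ℝ) : ℂ) * c := by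
    have h1 : Q⁻¹ * q ^ 2 = Q * Q' ^ 2 := by rw [hqe]; field_simp
    have h2 : P⁻¹ * p ^ 2 = P * P' ^ 2 := by rw [hpe]; field_simp
    rw [hB, ← h1, ← h2]
    push_cast
    ring
  rw [he]
  refine (norm_add_le _ _).trans_lt ?_
  rw [norm_mul, hc, Complex.norm_real, Complex.norm_real, Real.norm_of_nonneg hB0,
    Real.norm_of_nonneg (by positivity)]
  have h3 : φ * (P⁻¹ + Q⁻¹) * (p * q) = φ * (P' * Q' * (P + Q)) := by
    rw [hpe, hqe]; field_simp; ring
  rw [h3, hB]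
  have h4 : 0 < (q - p) * (Q' - P') := mul_pos (sub_pos.2 hpq) (sub_pos.2 hPQ')
  have h5 : (q - p) * (Q' - P') = P * P' ^ 2 + Q * Q' ^ 2 - P' * Q' * (P + Q) := by
    rw [hpe, hqe]; ring
  nlinarith [mul_pos hφ h4]

/-- The number is the convex combination (1 - l) · 1 + l · u with u = c / p^2 in the closed unit
disc and u ≠ 1; strict convexity gives the bound. -/
lemma norm_one_sub_lt_one_of_eq {l p : ℝ} {c : ℂ} (hl : l ∈ Set.Ioo (0 : ℝ) 1) (hp : 0 < p)
    (hc : ‖c‖ = p * p) (hne : c ≠ ((p ^ 2 : ℝ) : ℂ)) :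
    ‖1 - (dividedDiff l p p : ℂ) * (((p ^ (-l) : ℝ) : ℂ) * (((p ^ 2 : ℝ) : ℂ) - c) +
      ((p ^ (-l) : ℝ) : ℂ) * (((p ^ 2 : ℝ) : ℂ) - c))‖ < 1 := by
  have hpc : (p : ℂ) ≠ 0 := by exact_mod_cast hp.ne'
  have hP : ((p ^ l : ℝ) : ℂ) ≠ 0 := by exact_mod_cast (Real.rpow_pos_of_pos hp l).ne'
  set u : ℂ := c / ((p ^ 2 : ℝ) : ℂ) with hu
  have hun : ‖u‖ ≤ 1 := by
    rw [hu, norm_div, hc, Complex.norm_real, Real.norm_of_nonneg (by positivity), ← pow_two,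
      div_self (by positivity)]
  have hu1 : (1 : ℂ) ≠ u := by
    intro h
    apply hne
    rw [hu, eq_div_iff (by exact_mod_cast (pow_pos hp 2).ne'), one_mul] at h
    exact h.symm
  have h := norm_combo_lt_of_ne (norm_one (α := ℂ)).le hun hu1 (sub_pos.2 hl.2) hl.1
    (sub_add_cancel 1 l)
  refine lt_of_eq_of_lt (congrArg _ ?_) h
  rw [dividedDiff_self hp, Real.rpow_neg hp.le, hu, Complex.real_smul, Complex.real_smul]
  push_cast at hP ⊢
  field_simp
  ring

/-- The eigenvalues of the derivative transverse to the unitary orbit lie in the open unit disc. -/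
lemma norm_one_sub_stableCoeff_lt_one {r : ℕ} {l : ℝ} (hl : l ∈ Set.Ioo (0 : ℝ) 1) {d : Fin r → ℂ}
    (hd : ∀ i, d i ≠ 0) {i j : Fin r} (hij : d i ≠ d j) :
    ‖1 - (stableCoeff l d i j + star (stableCoeff l d j i))‖ < 1 := by
  have hp := norm_pos_iff.2 (hd i)
  have hq := norm_pos_iff.2 (hd j)
  have hc : ‖star (d i) * d j‖ = ‖d i‖ * ‖d j‖ := by rw [norm_mul, norm_star]
  rw [star_stableCoeff, stableCoeff]
  rcases lt_trichotomy ‖d i‖ ‖d j‖ with h | h | h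
  · convert norm_one_sub_lt_one_of_lt hl hp h hc using 3
    push_cast; ring
  · rw [← h] at hc ⊢
    have hne : star (d i) * d j ≠ ((‖d i‖ ^ 2 : ℝ) : ℂ) := by
      have : ((‖d i‖ ^ 2 : ℝ) : ℂ) = star (d i) * d i := by simp [RCLike.conj_mul]
      rw [this]
      exact fun he => hij (mul_left_cancel₀ (star_ne_zero.2 (hd i)) he).symm
    convert norm_one_sub_lt_one_of_eq hl hp hc hne using 3
    push_cast; ring
  · rw [mul_comm ‖d i‖] at hc
    rw [dividedDiff_comm]
    convert norm_one_sub_lt_one_of_lt hl hq h hc using 3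
    push_cast; ring

lemma stableCoeff_eq_of_norm_eq {r : ℕ} (l : ℝ) {d : Fin r → ℂ} {i j : Fin r}
    (h : ‖d i‖ = ‖d j‖) : star (stableCoeff l d j i) = stableCoeff l d i j := by
  rw [star_stableCoeff, stableCoeff, h]

/-- In cross-multiplied form: the ratio a_ij / conj a_ji depends on l only through (|d i| / |d
j|)^l, which is injective in l when the moduli differ. -/
lemma stableCoeff_cross_ne {r : ℕ} {d : Fin r → ℂ} (hd : ∀ i, d i ≠ 0) {i j : Fin r}
    (h : ‖d i‖ ≠ ‖d j‖) {l l' : ℝ} (hl : 0 < l) (hl' : 0 < l') (hne : l ≠ l') :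
    stableCoeff l d i j * star (stableCoeff l' d j i) ≠
      stableCoeff l' d i j * star (stableCoeff l d j i) := by
  have hp := norm_pos_iff.2 (hd i)
  have hq := norm_pos_iff.2 (hd j)
  have hφ : ∀ l : ℝ, 0 < l → (dividedDiff l ‖d i‖ ‖d j‖ : ℂ) ≠ 0 := fun l hl h0 => by
    have h1 := dividedDiff_mul (l := l) hp hq
    rw [Complex.ofReal_eq_zero.1 h0, zero_mul] at h1
    exact h ((Real.rpow_left_inj hp.le hq.le hl.ne').1 (sub_eq_zero.1 h1.symm).symm)
  have hc : ‖star (d i) * d j‖ = ‖d i‖ * ‖d j‖ := by rw [norm_mul, norm_star]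
  have h1 : ((‖d j‖ ^ 2 : ℝ) : ℂ) - star (d i) * d j ≠ 0 := fun h0 => by
    rw [← sub_eq_zero.1 h0, Complex.norm_real, Real.norm_of_nonneg (by positivity), pow_two] at hc
    exact h (mul_right_cancel₀ hq.ne' hc).symm
  have h2 : ((‖d i‖ ^ 2 : ℝ) : ℂ) - star (d i) * d j ≠ 0 := fun h0 => by
    rw [← sub_eq_zero.1 h0, Complex.norm_real, Real.norm_of_nonneg (by positivity), pow_two] at hc
    exact h (mul_left_cancel₀ hp.ne' hc)
  intro he
  rw [star_stableCoeff, star_stableCoeff, stableCoeff, stableCoeff] at he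
  push_cast at he h1 h2
  have h3 : ((‖d j‖ ^ (-l) : ℝ) : ℂ) * ((‖d i‖ ^ (-l') : ℝ) : ℂ) =
      ((‖d j‖ ^ (-l') : ℝ) : ℂ) * ((‖d i‖ ^ (-l) : ℝ) : ℂ) := by
    have h4 := mul_ne_zero (mul_ne_zero (hφ l hl) (hφ l' hl')) (mul_ne_zero h1 h2)
    apply mul_left_cancel₀ h4
    linear_combination he
  have h4 : ‖d j‖ ^ (-l) * ‖d i‖ ^ (-l') = ‖d j‖ ^ (-l') * ‖d i‖ ^ (-l) := by exact_mod_cast h3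
  have h5 : ‖d j‖ ^ (l' - l) = ‖d i‖ ^ (l' - l) := by
    rw [sub_eq_add_neg, Real.rpow_add hq, Real.rpow_add hp]
    have e1 : ‖d j‖ ^ l' * ‖d j‖ ^ (-l') = 1 := by rw [← Real.rpow_add hq]; simp
    have e2 : ‖d i‖ ^ l' * ‖d i‖ ^ (-l') = 1 := by rw [← Real.rpow_add hp]; simp
    linear_combination (‖d j‖ ^ l' * ‖d i‖ ^ l') * h4 - ‖d j‖ ^ l' * ‖d j‖ ^ (-l) * e2 +
      ‖d i‖ ^ l' * ‖d i‖ ^ (-l) * e1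
  exact h ((Real.rpow_left_inj hp.le hq.le (sub_ne_zero.2 hne.symm)).1 h5.symm)

end Coefficients

end AluthgeStable

namespace AluthgeStable

/-! ### The stable subspace at the diagonal matrix -/

section DiagonalPoint

variable {r : ℕ}

/-- The image of the tangent space of the similarity orbit under `1 - T_N Δ_l`. -/
def stableSubspace (l : ℝ) (D N : Matrix (Fin r) (Fin r) ℂ) :
    Submodule ℝ (Matrix (Fin r) (Fin r) ℂ) :=
  (tangentSpaceAt (similarityOrbit D) N).map
    (LinearMap.id - (fderiv ℝ (aluthge l) N).toLinearMap)

lemma mem_stableSubspace {l : ℝ} {D N X : Matrix (Fin r) (Fin r) ℂ} :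
    X ∈ stableSubspace l D N ↔
      ∃ Y ∈ tangentSpaceAt (similarityOrbit D) N, Y - fderiv ℝ (aluthge l) N Y = X := Iff.rfl

/-- A stable subspace is the image of `1 - T_N Δ_l`. -/
lemma IsStableSubspace.eq_stableSubspace {l : ℝ} {D N : Matrix (Fin r) (Fin r) ℂ}
    {F : Submodule ℝ (Matrix (Fin r) (Fin r) ℂ)} (hF : IsStableSubspace D l N F)
    (hfix : ∀ X ∈ tangentSpaceAt (unitaryOrbit D) N, fderiv ℝ (aluthge l) N X = X) :
    F = stableSubspace l D N := by
  set L := fderiv ℝ (aluthge l) N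
  obtain ⟨k, hk, hkF⟩ := hF.contracting
  set A : Matrix (Fin r) (Fin r) ℂ →ₗ[ℝ] Matrix (Fin r) (Fin r) ℂ :=
    LinearMap.id - L.toLinearMap with hA
  have hAF : ∀ X ∈ F, A X ∈ F := fun X hX => F.sub_mem hX (hF.invariant X hX)
  -- A fixed vector X in F satisfies ‖X‖ ≤ k ‖X‖ with k < 1, so it vanishes; in finite dimension 1 -
  -- L is then onto F.
  have hinj : Function.Injective (A.restrict hAF) := by
    rw [← LinearMap.ker_eq_bot, LinearMap.ker_eq_bot']
    rintro ⟨X, hX⟩ h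
    have h1 : X - L X = 0 := congrArg Subtype.val h
    have h2 := hkF X hX
    rw [← sub_eq_zero.1 h1] at h2
    have h3 : ‖X‖ = 0 := by nlinarith [norm_nonneg X]
    exact Subtype.ext (norm_eq_zero.1 h3)
  have hsurj := LinearMap.injective_iff_surjective.1 hinj
  apply le_antisymm
  · intro X hX
    obtain ⟨⟨Y, hY⟩, h⟩ := hsurj ⟨X, hX⟩
    refine ⟨Y, ?_, congrArg Subtype.val h⟩
    exact hF.sup_eq ▸ Submodule.mem_sup_left (T := tangentSpaceAt (unitaryOrbit D) N) hY
  · rintro _ ⟨Y, hY, rfl⟩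
    rw [SetLike.mem_coe, ← hF.sup_eq] at hY
    obtain ⟨Y₁, h₁, Y₂, h₂, rfl⟩ := Submodule.mem_sup.1 hY
    have h3 : A Y₂ = 0 := sub_eq_zero.2 (hfix Y₂ h₂).symm
    rw [← hA, map_add, h3, add_zero]
    exact hAF Y₁ h₁

lemma differentiableAt_aluthge_diagonal {l : ℝ} (hl : l ≠ 0) {d : Fin r → ℂ} (hd : ∀ i, d i ≠ 0) :
    DifferentiableAt ℝ (aluthge l) (Matrix.diagonal d) := by
  obtain ⟨L, hL, -⟩ := exists_hasFDerivAt_aluthge_diagonal hl d hd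
  exact hL.differentiableAt

/-- The derivative of the Aluthge transform on commutators. -/
lemma sub_fderiv_aluthge_diagonal {l : ℝ} (hl : l ≠ 0) {d : Fin r → ℂ} (hd : ∀ i, d i ≠ 0)
    {X : Matrix (Fin r) (Fin r) ℂ} (hX : X ∈ similarityTangent d) (i j : Fin r) :
    (X - fderiv ℝ (aluthge l) (Matrix.diagonal d) X) i j = stableCoeff l d i j *
      (commutatorPreimage d X i j + star (commutatorPreimage d X j i)) * (d j - d i) := by
  obtain ⟨L, hL, hLe⟩ := exists_hasFDerivAt_aluthge_diagonal hl d hd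
  have hXY : ∀ i j, X i j = commutatorPreimage d X i j * (d j - d i) := fun i j => by
    conv_lhs => rw [← commutatorPreimage_spec hX]
    rw [Matrix.sub_apply, Matrix.mul_diagonal, Matrix.diagonal_mul]
    ring
  have hp := norm_pos_iff.2 (hd i)
  have hq := norm_pos_iff.2 (hd j)
  have hsq : ∀ i, ((‖d i‖ ^ 2 : ℝ) : ℂ) = star (d i) * d i := fun i => by simp [RCLike.conj_mul]
  rw [hL.fderiv, Matrix.sub_apply, hLe, hXY i j, hXY j i, ← dividedDiff, stableCoeff]
  generalize commutatorPreimage d X = Y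
  have h1 : (dividedDiff l ‖d i‖ ‖d j‖ : ℂ) * (star (d j) * d j - star (d i) * d i) =
      ((‖d j‖ ^ l : ℝ) : ℂ) - ((‖d i‖ ^ l : ℝ) : ℂ) := by
    rw [← hsq, ← hsq]
    exact_mod_cast dividedDiff_mul hp hq
  have h2 : ((‖d j‖ ^ (-l) : ℝ) : ℂ) * ((‖d j‖ ^ l : ℝ) : ℂ) = 1 := by
    rw [← Complex.ofReal_mul, ← Real.rpow_add hq]; simp
  rw [hsq j, Complex.ofReal_mul]
  simp only [star_mul', star_sub]
  linear_combination (-(Y i j * (d j - d i))) * h2 -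
    ((‖d j‖ ^ (-l) : ℝ) : ℂ) * Y i j * (d j - d i) * h1

lemma fderiv_aluthge_diagonal_of_mem_unitaryTangent {l : ℝ} (hl : l ≠ 0) {d : Fin r → ℂ}
    (hd : ∀ i, d i ≠ 0) {X : Matrix (Fin r) (Fin r) ℂ} (hX : X ∈ unitaryTangent d) :
    fderiv ℝ (aluthge l) (Matrix.diagonal d) X = X := by
  symm
  rw [← sub_eq_zero]
  ext i j
  have h := congrFun (congrFun (star_commutatorPreimage hX) i) j
  rw [Matrix.star_apply, Matrix.neg_apply] at h
  rw [sub_fderiv_aluthge_diagonal hl hd hX.1, h]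
  simp

/-- Skewness of Y matters only off the equal eigenvalues, since the factor d j - d i kills the other
entries. -/
lemma mem_unitaryTangent_of_skew {d : Fin r → ℂ} {X Y : Matrix (Fin r) (Fin r) ℂ}
    (hX : ∀ i j, X i j = Y i j * (d j - d i))
    (hY : ∀ i j, d i ≠ d j → Y i j + star (Y j i) = 0) : X ∈ unitaryTangent d := by
  refine ⟨fun i j h => by rw [hX, h]; simp, fun i j => ?_⟩
  by_cases h : d i = d j
  · rw [h]; simp
  · rw [hX, hX, eq_neg_of_add_eq_zero_left (hY i j h)]
    simp only [star_mul', star_sub]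
    ring

/-- Coordinates on the stable subspace at a diagonal matrix. -/
lemma mem_stableSubspace_diagonal {l : ℝ} (hl : l ≠ 0) {d : Fin r → ℂ} (hd : ∀ i, d i ≠ 0)
    {X : Matrix (Fin r) (Fin r) ℂ} :
    X ∈ stableSubspace l (Matrix.diagonal d) (Matrix.diagonal d) ↔
      ∃ Z : Matrix (Fin r) (Fin r) ℂ, (∀ i j, star (Z j i) = Z i j) ∧
        ∀ i j, X i j = stableCoeff l d i j * Z i j * (d j - d i) := by
  rw [mem_stableSubspace, tangentSpaceAt_similarityOrbit]
  constructor
  · rintro ⟨Y, hY, rfl⟩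
    refine ⟨Matrix.of fun i j => commutatorPreimage d Y i j + star (commutatorPreimage d Y j i),
      fun i j => ?_, fun i j => sub_fderiv_aluthge_diagonal hl hd hY i j⟩
    simp [add_comm]
  · rintro ⟨Z, hZ, hX⟩
    -- Halving makes the preimage plus its adjoint equal to Z off the equal eigenvalues, as Z is
    -- Hermitian.
    have hY : (Matrix.of fun i j => Z i j / 2 * (d j - d i)) ∈ similarityTangent d :=
      fun i j h => by simp [h]
    refine ⟨_, hY, ?_⟩
    ext i j
    rw [sub_fderiv_aluthge_diagonal hl hd hY, hX]
    by_cases h : d i = d j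
    · simp [h]
    · have h1 : d j - d i ≠ 0 := sub_ne_zero.2 (Ne.symm h)
      have h2 : d i - d j ≠ 0 := sub_ne_zero.2 h
      congr 2
      rw [commutatorPreimage, Matrix.of_apply, Matrix.of_apply, Matrix.of_apply, Matrix.of_apply,
        mul_div_cancel_right₀ _ h1, mul_div_cancel_right₀ _ h2, star_div₀, hZ]
      have : star (2 : ℂ) = 2 := Complex.conj_ofNat 2
      rw [this]
      ring

lemma stableSubspace_diagonal_le {l : ℝ} (hl : l ≠ 0) {d : Fin r → ℂ} (hd : ∀ i, d i ≠ 0) :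
    stableSubspace l (Matrix.diagonal d) (Matrix.diagonal d) ≤ similarityTangent d := by
  intro X hX
  obtain ⟨Z, -, h⟩ := (mem_stableSubspace_diagonal hl hd).1 hX
  exact fun i j hij => by rw [h, hij]; simp

/-- On the stable subspace the derivative acts entrywise by multiplication. -/
lemma fderiv_apply_of_mem_stableSubspace {l : ℝ} (hl : l ≠ 0) {d : Fin r → ℂ} (hd : ∀ i, d i ≠ 0)
    {X : Matrix (Fin r) (Fin r) ℂ}
    (hX : X ∈ stableSubspace l (Matrix.diagonal d) (Matrix.diagonal d)) (i j : Fin r) :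
    fderiv ℝ (aluthge l) (Matrix.diagonal d) X i j =
      (1 - (stableCoeff l d i j + star (stableCoeff l d j i))) * X i j := by
  have hXs := stableSubspace_diagonal_le hl hd hX
  obtain ⟨Z, hZ, hXe⟩ := (mem_stableSubspace_diagonal hl hd).1 hX
  have h := sub_fderiv_aluthge_diagonal hl hd hXs i j
  rw [Matrix.sub_apply] at h
  by_cases hij : d i = d j
  · rw [hXs i j hij, hij, sub_self, mul_zero, zero_sub, neg_eq_zero] at h
    rw [h, hXs i j hij, mul_zero]
  · have h1 : d j - d i ≠ 0 := sub_ne_zero.2 (Ne.symm hij)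
    have h2 : d i - d j ≠ 0 := sub_ne_zero.2 hij
    rw [commutatorPreimage, Matrix.of_apply, Matrix.of_apply, hXe i j, hXe j i,
      mul_div_cancel_right₀ _ h1, mul_div_cancel_right₀ _ h2, star_mul', hZ] at h
    rw [hXe i j]
    linear_combination -h

lemma frobenius_norm_le_mul {X Y : Matrix (Fin r) (Fin r) ℂ} {k : ℝ} (hk : 0 ≤ k)
    (h : ∀ i j, ‖Y i j‖ ≤ k * ‖X i j‖) : ‖Y‖ ≤ k * ‖X‖ := by
  rw [Matrix.frobenius_norm_def, Matrix.frobenius_norm_def, ← Real.sqrt_eq_rpow,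
    ← Real.sqrt_eq_rpow]
  apply Real.sqrt_le_iff.2 ⟨by positivity, ?_⟩
  rw [mul_pow, Real.sq_sqrt (by positivity), Finset.mul_sum]
  refine Finset.sum_le_sum fun i _ => ?_
  rw [Finset.mul_sum]
  refine Finset.sum_le_sum fun j _ => ?_
  rw [Real.rpow_two, Real.rpow_two, ← mul_pow]
  exact pow_le_pow_left₀ (norm_nonneg _) (h i j) 2

/-- The derivative is the identity on the unitary tangent space and an entrywise multiplication with
multipliers of modulus less than 1 on the range of 1 - L. This gives trivial intersection and
contraction; an explicit splitting gives the sum. -/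
theorem isStableSubspace_diagonal {l : ℝ} (hl : l ∈ Set.Ioo (0 : ℝ) 1) {d : Fin r → ℂ}
    (hd : ∀ i, d i ≠ 0) :
    IsStableSubspace (Matrix.diagonal d) l (Matrix.diagonal d)
      (stableSubspace l (Matrix.diagonal d) (Matrix.diagonal d)) := by
  have hl0 := hl.1.ne'
  have hne : ∀ i j, d i ≠ d j → stableCoeff l d i j + star (stableCoeff l d j i) ≠ 0 :=
    fun i j hij h0 => by
      have := norm_one_sub_stableCoeff_lt_one hl hd hij
      rw [h0] at this
      simp at this
  have hle := stableSubspace_diagonal_le hl0 hd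
  constructor
  · rw [tangentSpaceAt_unitaryOrbit, eq_bot_iff]
    rintro X ⟨hX, hXu⟩
    rw [Submodule.mem_bot]
    ext i j
    have h := fderiv_apply_of_mem_stableSubspace hl0 hd hX i j
    rw [fderiv_aluthge_diagonal_of_mem_unitaryTangent hl0 hd hXu] at h
    by_cases hij : d i = d j
    · exact hXu.1 i j hij
    · have : (stableCoeff l d i j + star (stableCoeff l d j i)) * X i j = 0 := by
        linear_combination h
      exact (mul_eq_zero.1 this).resolve_left (hne i j hij)
  · rw [tangentSpaceAt_unitaryOrbit, tangentSpaceAt_similarityOrbit]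
    apply le_antisymm
    · exact sup_le hle fun X hX => hX.1
    · intro X hX
      set Y := commutatorPreimage d X
      -- Z is forced by asking that Y - a ∘ Z be skew-Hermitian off the equal eigenvalues.
      set Z : Matrix (Fin r) (Fin r) ℂ := Matrix.of fun i j => (Y i j + star (Y j i)) /
        (stableCoeff l d i j + star (stableCoeff l d j i)) with hZ
      set X₁ : Matrix (Fin r) (Fin r) ℂ :=
        Matrix.of fun i j => stableCoeff l d i j * Z i j * (d j - d i) with hX₁
      have h₁ : X₁ ∈ stableSubspace l (Matrix.diagonal d) (Matrix.diagonal d) := by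
        refine (mem_stableSubspace_diagonal hl0 hd).2 ⟨Z, fun i j => ?_, fun i j => rfl⟩
        simp only [hZ, Matrix.of_apply, star_div₀, star_add, star_star]
        rw [add_comm, add_comm (star (stableCoeff l d j i))]
      have h₂ : X - X₁ ∈ unitaryTangent d := by
        refine mem_unitaryTangent_of_skew
          (Y := Matrix.of fun i j => Y i j - stableCoeff l d i j * Z i j)
          (fun i j => ?_) (fun i j hij => ?_)
        · rw [Matrix.sub_apply]
          conv_lhs => rw [← commutatorPreimage_spec hX]
          rw [Matrix.sub_apply, Matrix.mul_diagonal, Matrix.diagonal_mul, hX₁, Matrix.of_apply,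
            Matrix.of_apply]
          ring
        · have h1 := hne i j hij
          have h2 : star (Z j i) = Z i j := by
            simp only [hZ, Matrix.of_apply, star_div₀, star_add, star_star]
            rw [add_comm, add_comm (star (stableCoeff l d j i))]
          rw [Matrix.of_apply, Matrix.of_apply, star_sub, star_mul', h2]
          have h3 : Z i j * (stableCoeff l d i j + star (stableCoeff l d j i)) =
              Y i j + star (Y j i) := div_mul_cancel₀ _ h1
          linear_combination -h3
      rw [← add_sub_cancel X₁ X]
      exact Submodule.add_mem_sup h₁ h₂
  · intro X hX
    have h : fderiv ℝ (aluthge l) (Matrix.diagonal d) X =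
        X - (X - fderiv ℝ (aluthge l) (Matrix.diagonal d) X) := by abel
    rw [h]
    refine Submodule.sub_mem _ hX (mem_stableSubspace.2 ⟨X, ?_, rfl⟩)
    rw [tangentSpaceAt_similarityOrbit]
    exact hle hX
  · rw [tangentSpaceAt_unitaryOrbit]
    intro X hX
    rwa [fderiv_aluthge_diagonal_of_mem_unitaryTangent hl0 hd hX]
  · have hk : ∃ k : ℝ, 0 ≤ k ∧ k < 1 ∧ ∀ i j, d i ≠ d j →
        ‖1 - (stableCoeff l d i j + star (stableCoeff l d j i))‖ ≤ k := by
      have : ∀ᶠ k in nhdsWithin (1 : ℝ) (Set.Iio 1), ∀ i j, d i ≠ d j →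
          ‖1 - (stableCoeff l d i j + star (stableCoeff l d j i))‖ ≤ k := by
        refine Filter.eventually_all.2 fun i => Filter.eventually_all.2 fun j => ?_
        by_cases hij : d i = d j
        · simp [hij]
        · filter_upwards [Ioo_mem_nhdsLT (norm_one_sub_stableCoeff_lt_one hl hd hij)] with k hk _
          exact hk.1.le
      obtain ⟨k, hk, hk2⟩ := (this.and (Ioo_mem_nhdsLT (zero_lt_one (α := ℝ)))).exists
      exact ⟨k, hk2.1.le, hk2.2, hk⟩
    obtain ⟨k, hk0, hk1, hk⟩ := hk
    refine ⟨k, hk1, fun X hX => frobenius_norm_le_mul hk0 fun i j => ?_⟩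
    rw [fderiv_apply_of_mem_stableSubspace hl0 hd hX, norm_mul]
    by_cases hij : d i = d j
    · rw [hle hX i j hij]; simp
    · exact mul_le_mul_of_nonneg_right (hk i j hij) (norm_nonneg _)

/-- Distinct moduli make the stable subspace depend on the parameter. -/
lemma stableSubspace_diagonal_ne {d : Fin r → ℂ} (hd : ∀ i, d i ≠ 0) {i j : Fin r}
    (hij : ‖d i‖ ≠ ‖d j‖) {l l' : ℝ} (hl : 0 < l) (hl' : 0 < l') (hne : l ≠ l') :
    stableSubspace l (Matrix.diagonal d) (Matrix.diagonal d) ≠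
      stableSubspace l' (Matrix.diagonal d) (Matrix.diagonal d) := by
  intro h
  -- The test vector takes Z with all entries 1. Membership for l' writes its coefficients as a'_ij
  -- Z i j with Z Hermitian, which equates the ratios at l and l'.
  have hX : (Matrix.of fun i j => stableCoeff l d i j * (d j - d i)) ∈
      stableSubspace l (Matrix.diagonal d) (Matrix.diagonal d) :=
    (mem_stableSubspace_diagonal hl.ne' hd).2
      ⟨Matrix.of fun _ _ => 1, fun _ _ => by simp, fun _ _ => by simp⟩
  rw [h] at hX
  obtain ⟨Z, hZ, hXe⟩ := (mem_stableSubspace_diagonal hl'.ne' hd).1 hX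
  have hne' : d i ≠ d j := fun h => hij (by rw [h])
  have h1 : stableCoeff l d i j = stableCoeff l' d i j * Z i j :=
    mul_right_cancel₀ (sub_ne_zero.2 hne'.symm) (hXe i j)
  have h2 : stableCoeff l d j i = stableCoeff l' d j i * Z j i :=
    mul_right_cancel₀ (sub_ne_zero.2 hne') (hXe j i)
  apply stableCoeff_cross_ne hd hij hl hl' hne
  rw [h1, h2, star_mul', hZ]
  ring

/-- For equal moduli, the stable subspace at a diagonal matrix is the orthogonal complement. -/
lemma stableSubspace_diagonal_eq_orthIn {d : Fin r → ℂ} (hd : ∀ i, d i ≠ 0)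
    (h : ∀ i j, ‖d i‖ = ‖d j‖) {l : ℝ} (hl : l ∈ Set.Ioo (0 : ℝ) 1) :
    stableSubspace l (Matrix.diagonal d) (Matrix.diagonal d) =
      orthIn (tangentSpaceAt (similarityOrbit (Matrix.diagonal d)) (Matrix.diagonal d))
        (tangentSpaceAt (unitaryOrbit (Matrix.diagonal d)) (Matrix.diagonal d)) := by
  have hs := isStableSubspace_diagonal hl hd
  have hle : stableSubspace l (Matrix.diagonal d) (Matrix.diagonal d) ≤
      orthIn (tangentSpaceAt (similarityOrbit (Matrix.diagonal d)) (Matrix.diagonal d))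
        (tangentSpaceAt (unitaryOrbit (Matrix.diagonal d)) (Matrix.diagonal d)) := by
    intro X hX
    refine ⟨hs.sup_eq ▸ Submodule.mem_sup_left hX, fun W hW => ?_⟩
    rw [tangentSpaceAt_unitaryOrbit] at hW
    obtain ⟨Z, hZ, hXe⟩ := (mem_stableSubspace_diagonal hl.1.ne' hd).1 hX
    -- Swapping i and j turns each term of the trace into minus its conjugate, so the trace is
    -- purely imaginary.
    have hterm : ∀ i j, star (W i j) * X i j = -star (star (W j i) * X j i) := fun i j => by
      by_cases hij : d i = d j
      · rw [hW.1 i j hij, hW.1 j i hij.symm]; simp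
      · have h1 : d j - d i ≠ 0 := sub_ne_zero.2 (Ne.symm hij)
        have h2 : star (d j - d i) ≠ 0 := star_ne_zero.2 h1
        have h3 := hW.2 j i
        have h4 : star (X j i) * (d j - d i) = -(X i j * star (d j - d i)) := by
          rw [hXe i j, hXe j i, star_mul', star_mul', hZ, stableCoeff_eq_of_norm_eq l (h i j)]
          simp only [star_sub]
          ring
        have h3' : W j i * star (d j - d i) = (d j - d i) * star (W i j) := by
          simp only [star_sub] at h3 ⊢
          linear_combination -h3
        apply mul_left_cancel₀ h1
        apply mul_left_cancel₀ h2
        simp only [star_mul', star_star]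
        linear_combination (-(X i j * star (d j - d i))) * h3' +
          W j i * star (d j - d i) * h4
    have htr : (Wᴴ * X).trace = ∑ i, ∑ j, star (W i j) * X i j := by
      rw [Matrix.trace, Finset.sum_comm]
      simp [Matrix.mul_apply]
    have hneg : (Wᴴ * X).trace = -star (Wᴴ * X).trace := by
      conv_lhs => rw [htr, Finset.sum_comm]
      rw [htr, star_sum, ← Finset.sum_neg_distrib]
      refine Finset.sum_congr rfl fun i _ => ?_
      rw [star_sum, ← Finset.sum_neg_distrib]
      exact Finset.sum_congr rfl fun j _ => hterm j i
    have hre := congrArg Complex.re hneg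
    rw [Complex.neg_re, RCLike.star_def, Complex.conj_re] at hre
    linarith
  refine le_antisymm hle fun X hX => ?_
  have hXV := hX.1
  rw [← hs.sup_eq] at hXV
  obtain ⟨X₁, h₁, X₂, h₂, rfl⟩ := Submodule.mem_sup.1 hXV
  have h3 := Submodule.sub_mem _ hX (hle h₁)
  rw [add_sub_cancel_left] at h3
  have h4 := h3.2 X₂ h₂
  -- The unitary tangent component X₂ is orthogonal to itself.
  have h5 : X₂ = 0 := by
    have h6 : (X₂ᴴ * X₂).trace = ((∑ i, ∑ j, ‖X₂ j i‖ ^ 2 : ℝ) : ℂ) := by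
      rw [Matrix.trace]
      simp [Matrix.mul_apply, RCLike.conj_mul]
    rw [h6, Complex.ofReal_re] at h4
    ext i j
    have h7 := (Finset.sum_eq_zero_iff_of_nonneg
      (fun _ _ => Finset.sum_nonneg fun _ _ => sq_nonneg _)).1 h4 j (Finset.mem_univ j)
    have h8 := (Finset.sum_eq_zero_iff_of_nonneg (fun _ _ => sq_nonneg _)).1 h7 i
      (Finset.mem_univ i)
    simpa using h8
  rwa [h5, add_zero]

end DiagonalPoint

end AluthgeStable

namespace AluthgeStable

/-! ### Transport along the unitary orbit -/

section UnitaryConjugation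

variable {r : ℕ}

/-- Conjugation `X ↦ U X U*` by a unitary matrix. -/
def unitaryConj (U : unitary (Matrix (Fin r) (Fin r) ℂ)) :
    Matrix (Fin r) (Fin r) ℂ ≃L[ℝ] Matrix (Fin r) (Fin r) ℂ :=
  LinearEquiv.toContinuousLinearEquiv
    ((Unitary.conjStarAlgAut ℝ (Matrix (Fin r) (Fin r) ℂ) U).toAlgEquiv.toLinearEquiv)

lemma unitaryConj_apply (U : unitary (Matrix (Fin r) (Fin r) ℂ)) (X : Matrix (Fin r) (Fin r) ℂ) :
    unitaryConj U X = U * X * (star U : Matrix (Fin r) (Fin r) ℂ) := rfl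

lemma star_mul_unitaryConj_trace (U : unitary (Matrix (Fin r) (Fin r) ℂ))
    (X Y : Matrix (Fin r) (Fin r) ℂ) :
    ((unitaryConj U Y)ᴴ * unitaryConj U X).trace = (Yᴴ * X).trace := by
  have hU : (star U : Matrix (Fin r) (Fin r) ℂ) * U = 1 := Unitary.coe_star_mul_self U
  rw [unitaryConj_apply, unitaryConj_apply, ← Matrix.star_eq_conjTranspose, star_mul, star_mul,
    star_star, Matrix.trace_mul_comm]
  simp only [Matrix.mul_assoc]
  rw [← Matrix.mul_assoc (star (U : Matrix (Fin r) (Fin r) ℂ)) (U : Matrix (Fin r) (Fin r) ℂ), hU,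
    Matrix.one_mul, Matrix.trace_mul_comm]
  simp only [Matrix.mul_assoc]
  rw [hU, Matrix.mul_one, Matrix.trace_mul_comm, Matrix.star_eq_conjTranspose]

lemma frobenius_norm_sq (X : Matrix (Fin r) (Fin r) ℂ) : ‖X‖ ^ 2 = ((Xᴴ * X).trace).re := by
  rw [Matrix.frobenius_norm_def, ← Real.sqrt_eq_rpow, Real.sq_sqrt (by positivity)]
  have h : (Xᴴ * X).trace = ((∑ i, ∑ j, ‖X j i‖ ^ 2 : ℝ) : ℂ) := by
    rw [Matrix.trace]
    simp [Matrix.mul_apply, RCLike.conj_mul]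
  rw [h, Complex.ofReal_re, Finset.sum_comm]
  simp_rw [Real.rpow_two]

lemma norm_unitaryConj (U : unitary (Matrix (Fin r) (Fin r) ℂ)) (X : Matrix (Fin r) (Fin r) ℂ) :
    ‖unitaryConj U X‖ = ‖X‖ := by
  rw [← sq_eq_sq₀ (norm_nonneg _) (norm_nonneg _), frobenius_norm_sq, frobenius_norm_sq,
    star_mul_unitaryConj_trace]

lemma unitaryConj_mul (U : unitary (Matrix (Fin r) (Fin r) ℂ)) (X Y : Matrix (Fin r) (Fin r) ℂ) :
    unitaryConj U (X * Y) = unitaryConj U X * unitaryConj U Y :=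
  map_mul (Unitary.conjStarAlgAut ℝ (Matrix (Fin r) (Fin r) ℂ) U) X Y

lemma unitaryConj_conjTranspose (U : unitary (Matrix (Fin r) (Fin r) ℂ))
    (X : Matrix (Fin r) (Fin r) ℂ) : unitaryConj U Xᴴ = (unitaryConj U X)ᴴ :=
  map_star (Unitary.conjStarAlgAut ℝ (Matrix (Fin r) (Fin r) ℂ) U) X

/-- Conjugation is a star automorphism, and the continuous functional calculus commutes with those;
continuity of the power is free on a finite spectrum. -/
lemma unitaryConj_absPow (U : unitary (Matrix (Fin r) (Fin r) ℂ)) (X : Matrix (Fin r) (Fin r) ℂ)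
    (s : ℝ) : unitaryConj U (absPow X s) = absPow (unitaryConj U X) s := by
  rw [absPow, absPow, ← unitaryConj_conjTranspose, ← unitaryConj_mul]
  exact StarAlgHomClass.map_cfc (S := ℝ) (Unitary.conjStarAlgAut ℝ (Matrix (Fin r) (Fin r) ℂ) U) _ _
    ((spectrum_real_finite X).continuousOn _) (unitaryConj U).continuous
    (Matrix.isHermitian_conjTranspose_mul_self X)
    (by
      have h := Matrix.isHermitian_conjTranspose_mul_self (unitaryConj U X)
      rw [← unitaryConj_conjTranspose, ← unitaryConj_mul] at h
      exact h)

lemma unitaryConj_aluthge (U : unitary (Matrix (Fin r) (Fin r) ℂ)) (l : ℝ)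
    (X : Matrix (Fin r) (Fin r) ℂ) :
    unitaryConj U (aluthge l X) = aluthge l (unitaryConj U X) := by
  simp only [aluthge, polarFactor, unitaryConj_mul, unitaryConj_absPow]

lemma unitaryConj_star_apply (U : unitary (Matrix (Fin r) (Fin r) ℂ))
    (X : Matrix (Fin r) (Fin r) ℂ) : unitaryConj (star U) (unitaryConj U X) = X := by
  have hU : (star U : Matrix (Fin r) (Fin r) ℂ) * U = 1 := Unitary.coe_star_mul_self U
  rw [unitaryConj_apply, unitaryConj_apply, Unitary.coe_star, star_star]
  simp only [Matrix.mul_assoc]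
  rw [hU, Matrix.mul_one, ← Matrix.mul_assoc, hU, Matrix.one_mul]

lemma hasFDerivAt_aluthge_unitaryConj (U : unitary (Matrix (Fin r) (Fin r) ℂ)) {l : ℝ}
    {T : Matrix (Fin r) (Fin r) ℂ} (h : DifferentiableAt ℝ (aluthge l) T) :
    HasFDerivAt (aluthge l) ((unitaryConj U : _ →L[ℝ] Matrix (Fin r) (Fin r) ℂ).comp
      ((fderiv ℝ (aluthge l) T).comp (unitaryConj (star U) : _ →L[ℝ] Matrix (Fin r) (Fin r) ℂ)))
      (unitaryConj U T) := by
  have hfun : unitaryConj U ∘ aluthge l ∘ unitaryConj (star U) = aluthge l := by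
    funext X
    rw [Function.comp_apply, Function.comp_apply, unitaryConj_aluthge]
    have := unitaryConj_star_apply (star U) X
    rw [star_star] at this
    rw [this]
  have h1 : HasFDerivAt (aluthge l) (fderiv ℝ (aluthge l) T)
      (unitaryConj (star U) (unitaryConj U T)) := by
    rw [unitaryConj_star_apply]
    exact h.hasFDerivAt
  have h2 := (unitaryConj U).hasFDerivAt.comp _ (h1.comp _ (unitaryConj (star U)).hasFDerivAt)
  exact h2.congr_of_eventuallyEq (Filter.EventuallyEq.of_eq hfun.symm)

lemma fderiv_aluthge_unitaryConj (U : unitary (Matrix (Fin r) (Fin r) ℂ)) {l : ℝ}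
    {T : Matrix (Fin r) (Fin r) ℂ} (h : DifferentiableAt ℝ (aluthge l) T)
    (X : Matrix (Fin r) (Fin r) ℂ) :
    fderiv ℝ (aluthge l) (unitaryConj U T) (unitaryConj U X) =
      unitaryConj U (fderiv ℝ (aluthge l) T X) := by
  rw [(hasFDerivAt_aluthge_unitaryConj U h).fderiv]
  change unitaryConj U (fderiv ℝ (aluthge l) T (unitaryConj (star U) (unitaryConj U X))) = _
  rw [unitaryConj_star_apply]

/-- The tangent spaces of a set invariant under unitary conjugation are transported by it. -/
lemma tangentSpaceAt_unitaryConj {S : Set (Matrix (Fin r) (Fin r) ℂ)}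
    (hS : ∀ U : unitary (Matrix (Fin r) (Fin r) ℂ), ∀ X ∈ S, unitaryConj U X ∈ S)
    (U : unitary (Matrix (Fin r) (Fin r) ℂ)) (T : Matrix (Fin r) (Fin r) ℂ) :
    tangentSpaceAt S (unitaryConj U T) =
      (tangentSpaceAt S T).map (unitaryConj U).toLinearEquiv.toLinearMap := by
  have key : ∀ (U : unitary (Matrix (Fin r) (Fin r) ℂ)) (T : Matrix (Fin r) (Fin r) ℂ),
      (tangentSpaceAt S T).map (unitaryConj U).toLinearEquiv.toLinearMap ≤
        tangentSpaceAt S (unitaryConj U T) := by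
    intro U T
    rw [tangentSpaceAt, Submodule.map_span_le]
    rintro v ⟨γ, hγ, hmem, h0, hv⟩
    refine Submodule.subset_span ⟨fun t => unitaryConj U (γ t), (unitaryConj U).contDiff.comp hγ,
      fun t => hS U _ (hmem t), congrArg (unitaryConj U) h0, ?_⟩
    have h1 : HasDerivAt γ v 0 := hv ▸ (hγ.differentiable (by simp)).differentiableAt.hasDerivAt
    exact ((unitaryConj U).hasFDerivAt.comp_hasDerivAt (0 : ℝ) h1).deriv
  refine le_antisymm (fun X hX => ?_) (key U T)
  -- The reverse inclusion is the direct one for the inverse conjugation.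
  have h := key (star U) (unitaryConj U T) (Submodule.mem_map_of_mem hX)
  rw [unitaryConj_star_apply] at h
  refine ⟨_, h, ?_⟩
  have := unitaryConj_star_apply (star U) X
  rw [star_star] at this
  exact this

lemma unitaryConj_mem_unitaryOrbit {D : Matrix (Fin r) (Fin r) ℂ}
    (U : unitary (Matrix (Fin r) (Fin r) ℂ)) (X : Matrix (Fin r) (Fin r) ℂ)
    (hX : X ∈ unitaryOrbit D) : unitaryConj U X ∈ unitaryOrbit D := by
  obtain ⟨V, hV, rfl⟩ := hX
  refine ⟨U * V, mul_mem U.2 hV, ?_⟩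
  rw [unitaryConj_apply, Matrix.conjTranspose_mul,
    ← Matrix.star_eq_conjTranspose (U : Matrix (Fin r) (Fin r) ℂ)]
  simp only [Matrix.mul_assoc]

lemma unitaryConj_mem_similarityOrbit {D : Matrix (Fin r) (Fin r) ℂ}
    (U : unitary (Matrix (Fin r) (Fin r) ℂ)) (X : Matrix (Fin r) (Fin r) ℂ)
    (hX : X ∈ similarityOrbit D) : unitaryConj U X ∈ similarityOrbit D := by
  obtain ⟨S, rfl⟩ := hX
  refine ⟨Unitary.toUnits U * S, ?_⟩
  rw [unitaryConj_apply, mul_inv_rev, Units.val_mul, Units.val_mul]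
  simp only [Matrix.mul_assoc]
  rfl

lemma exists_eq_unitaryConj {D N : Matrix (Fin r) (Fin r) ℂ} (hN : N ∈ unitaryOrbit D) :
    ∃ U : unitary (Matrix (Fin r) (Fin r) ℂ), N = unitaryConj U D := by
  obtain ⟨U, hU, rfl⟩ := hN
  exact ⟨⟨U, hU⟩, rfl⟩

lemma map_unitaryConj_orthIn (U : unitary (Matrix (Fin r) (Fin r) ℂ))
    (V F : Submodule ℝ (Matrix (Fin r) (Fin r) ℂ)) :
    (orthIn V F).map (unitaryConj U).toLinearEquiv.toLinearMap =
      orthIn (V.map (unitaryConj U).toLinearEquiv.toLinearMap)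
        (F.map (unitaryConj U).toLinearEquiv.toLinearMap) := by
  ext X
  constructor
  · rintro ⟨Y, ⟨hY, hYF⟩, rfl⟩
    refine ⟨Submodule.mem_map_of_mem hY, ?_⟩
    rintro _ ⟨W, hW, rfl⟩
    exact (congrArg Complex.re (star_mul_unitaryConj_trace U Y W)).trans (hYF W hW)
  · rintro ⟨⟨Y, hY, rfl⟩, hYF⟩
    refine ⟨Y, ⟨hY, fun W hW => ?_⟩, rfl⟩
    exact (congrArg Complex.re (star_mul_unitaryConj_trace U Y W)).symm.trans
      (hYF _ (Submodule.mem_map_of_mem hW))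

lemma map_unitaryConj_stableSubspace (U : unitary (Matrix (Fin r) (Fin r) ℂ)) {l : ℝ}
    {D T : Matrix (Fin r) (Fin r) ℂ} (h : DifferentiableAt ℝ (aluthge l) T) :
    stableSubspace l D (unitaryConj U T) =
      (stableSubspace l D T).map (unitaryConj U).toLinearEquiv.toLinearMap := by
  have hmap := tangentSpaceAt_unitaryConj (unitaryConj_mem_similarityOrbit (D := D)) U T
  ext X
  rw [mem_stableSubspace, hmap]
  constructor
  · rintro ⟨_, ⟨Y, hY, rfl⟩, rfl⟩
    refine ⟨_, mem_stableSubspace.2 ⟨Y, hY, rfl⟩, ?_⟩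
    change unitaryConj U _ = unitaryConj U Y - fderiv ℝ (aluthge l) _ (unitaryConj U Y)
    rw [fderiv_aluthge_unitaryConj U h, map_sub]
  · rintro ⟨_, ⟨Y, hY, rfl⟩, rfl⟩
    refine ⟨_, Submodule.mem_map_of_mem hY, ?_⟩
    change unitaryConj U Y - fderiv ℝ (aluthge l) _ (unitaryConj U Y) = unitaryConj U (Y - fderiv ℝ (aluthge l) T Y)
    rw [fderiv_aluthge_unitaryConj U h, map_sub]

lemma IsStableSubspace.map_unitaryConj (U : unitary (Matrix (Fin r) (Fin r) ℂ)) {l : ℝ}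
    {D T : Matrix (Fin r) (Fin r) ℂ} (h : DifferentiableAt ℝ (aluthge l) T)
    {F : Submodule ℝ (Matrix (Fin r) (Fin r) ℂ)} (hF : IsStableSubspace D l T F) :
    IsStableSubspace D l (unitaryConj U T) (F.map (unitaryConj U).toLinearEquiv.toLinearMap) := by
  have hS := tangentSpaceAt_unitaryConj (unitaryConj_mem_similarityOrbit (D := D)) U T
  have hU := tangentSpaceAt_unitaryConj (unitaryConj_mem_unitaryOrbit (D := D)) U T
  constructor
  · rw [hU, ← Submodule.map_inf _ (unitaryConj U).injective, hF.inf_eq, Submodule.map_bot]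
  · rw [hU, hS, ← Submodule.map_sup, hF.sup_eq]
  · rintro _ ⟨X, hX, rfl⟩
    exact ⟨_, hF.invariant X hX, (fderiv_aluthge_unitaryConj U h X).symm⟩
  · rw [hU]
    rintro _ ⟨X, hX, rfl⟩
    exact ⟨_, hF.invariant_tangent X hX, (fderiv_aluthge_unitaryConj U h X).symm⟩
  · obtain ⟨k, hk, hkF⟩ := hF.contracting
    refine ⟨k, hk, ?_⟩
    rintro _ ⟨X, hX, rfl⟩
    change ‖fderiv ℝ (aluthge l) _ (unitaryConj U X)‖ ≤ k * ‖unitaryConj U X‖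
    rw [fderiv_aluthge_unitaryConj U h, norm_unitaryConj, norm_unitaryConj]
    exact hkF X hX

end UnitaryConjugation

end AluthgeStable

end

/-! ### The main theorem -/

open AluthgeStable

theorem lemma4p8 {r : ℕ} (d : Fin r → ℂ) (hD : IsUnit (Matrix.diagonal d)) :
    ∃ E : ℝ → Matrix (Fin r) (Fin r) ℂ → Submodule ℝ (Matrix (Fin r) (Fin r) ℂ),
      (∀ l ∈ Set.Ioo (0 : ℝ) 1, ∀ N ∈ AluthgeStable.unitaryOrbit (Matrix.diagonal d),
        DifferentiableAt ℝ (AluthgeStable.aluthge l) N ∧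
        ∀ F : Submodule ℝ (Matrix (Fin r) (Fin r) ℂ),
          AluthgeStable.IsStableSubspace (Matrix.diagonal d) l N F ↔ F = E l N) ∧
      ((∀ N ∈ AluthgeStable.unitaryOrbit (Matrix.diagonal d),
          ∀ l ∈ Set.Ioo (0 : ℝ) 1, ∀ l' ∈ Set.Ioo (0 : ℝ) 1, E l N = E l' N) ↔
        ∀ i j : Fin r, ‖d i‖ = ‖d j‖) ∧
      ((∀ i j : Fin r, ‖d i‖ = ‖d j‖) →
        ∀ N ∈ AluthgeStable.unitaryOrbit (Matrix.diagonal d), ∀ l ∈ Set.Ioo (0 : ℝ) 1,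
          E l N = AluthgeStable.orthIn
            (AluthgeStable.tangentSpaceAt
              (AluthgeStable.similarityOrbit (Matrix.diagonal d)) N)
            (AluthgeStable.tangentSpaceAt
              (AluthgeStable.unitaryOrbit (Matrix.diagonal d)) N)) := by
  have hd : ∀ i, d i ≠ 0 := fun i => by
    have h := (Matrix.isUnit_diagonal.1 hD)
    exact (Pi.isUnit_iff.1 h i).ne_zero
  have hdiff : ∀ l ∈ Set.Ioo (0 : ℝ) 1, DifferentiableAt ℝ (aluthge l) (Matrix.diagonal d) :=
    fun l hl => differentiableAt_aluthge_diagonal hl.1.ne' hd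
  have horth : (∀ i j : Fin r, ‖d i‖ = ‖d j‖) →
      ∀ N ∈ unitaryOrbit (Matrix.diagonal d), ∀ l ∈ Set.Ioo (0 : ℝ) 1,
        stableSubspace l (Matrix.diagonal d) N =
          orthIn (tangentSpaceAt (similarityOrbit (Matrix.diagonal d)) N)
            (tangentSpaceAt (unitaryOrbit (Matrix.diagonal d)) N) := by
    intro h N hN l hl
    obtain ⟨U, rfl⟩ := exists_eq_unitaryConj hN
    rw [map_unitaryConj_stableSubspace U (hdiff l hl), stableSubspace_diagonal_eq_orthIn hd h hl,
      map_unitaryConj_orthIn,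
      tangentSpaceAt_unitaryConj (unitaryConj_mem_similarityOrbit (D := Matrix.diagonal d)),
      tangentSpaceAt_unitaryConj (unitaryConj_mem_unitaryOrbit (D := Matrix.diagonal d))]
  refine ⟨fun l N => stableSubspace l (Matrix.diagonal d) N, ?_, ⟨fun h i j => ?_, ?_⟩, horth⟩
  · intro l hl N hN
    obtain ⟨U, rfl⟩ := exists_eq_unitaryConj hN
    have hst := (isStableSubspace_diagonal hl hd).map_unitaryConj U (hdiff l hl)
    rw [← map_unitaryConj_stableSubspace U (hdiff l hl)] at hst
    refine ⟨(hasFDerivAt_aluthge_unitaryConj U (hdiff l hl)).differentiableAt, fun F =>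
      ⟨fun hF => hF.eq_stableSubspace ?_, fun hF => hF ▸ hst⟩⟩
    rw [tangentSpaceAt_unitaryConj (unitaryConj_mem_unitaryOrbit (D := Matrix.diagonal d)),
      tangentSpaceAt_unitaryOrbit]
    rintro _ ⟨X, hX, rfl⟩
    change fderiv ℝ (aluthge l) _ (unitaryConj U X) = unitaryConj U X
    rw [fderiv_aluthge_unitaryConj U (hdiff l hl),
      fderiv_aluthge_diagonal_of_mem_unitaryTangent hl.1.ne' hd hX]
  · by_contra hij
    -- Any two distinct parameters would do; the point N = D, reached with U = 1, already detects
    -- unequal moduli.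
    refine stableSubspace_diagonal_ne hd hij (l := 1 / 2) (l' := 1 / 4) (by norm_num) (by norm_num)
      (by norm_num) (h _ ⟨1, one_mem _, by simp⟩ _ ⟨by norm_num, by norm_num⟩ _
        ⟨by norm_num, by norm_num⟩)
  · intro h N hN l hl l' hl'
    exact (horth h N hN l hl).trans (horth h N hN l' hl').symm
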